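/- Let $A$ be a real $n\times d$ matrix with rows $a_1^T,\dots,a_n^T$, with $d\ge 1$ and of full column rank $d$, and let $p\ge 2$. The $\ell_p$ Lewis weights of $A$ are the unique nonnegative weights $\bar w\in\mathbb{R}^n$ such that, with $\bar W=\operatorname{diag}(\bar w)$, the matrix $A^T\bar W^{1-2/p}A$ is invertible and $$a_i^T\left(A^T\bar W^{1-2/p}A\right)^{-1}a_i=\bar w_i^{2/p}\qquad (1\le i\le n).$$ The Lewis quadratic form $Q$ is the unique maximizer of $\det M$ over all symmetric positive semidefinite $d\times d$ matrices $M$ with $\sum_{i=1}^n (a_i^TMa_i)^{p/2}\le d$. For $\alpha\ge 1$ write $x\approx_\alpha y$ if $\frac1\alpha x\le y\le\alpha x$; for symmetric matrices the inequalities are in the Loewner order. Theorem. There exist a function $f(p,\varepsilon)$, a constant $C$, and a single program for the real RAM (exact real arithmetic; unit cost for arithmetic operations, comparisons, powers $x^y$ of a base $x\ge 0$, and memory accesses; no rounding of reals to integers) such that the following holds for every $p\ge 2$, every $\varepsilon>0$ and every real $n\times d$ matrix $A$ with $d\ge 1$ and $\operatorname{rank}A=d$. The Lewis weights $\bar w$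 and the Lewis quadratic form $Q$ of $A$ exist and are unique, and on input $(n,d,A,p,\varepsilon)$ the program halts after at most $$f(p,\varepsilon)\; n\,\max\{1,\log n\}\,\max\{1,\log\log n\}\; d^{C}$$ steps (where the last maximum is $1$ for $n=1$) and outputs a vector $w\in\mathbb{R}^n$ with $w_i\approx_{1+\varepsilon}\bar w_i$ for all $i$, and a symmetric matrix $M\in\mathbb{R}^{d\times d}$ with $M\approx_{1+\varepsilon}Q$. -/

import Mathlib

/-! ## Lewis weights and the Lewis quadratic form -/

namespace LewisWeights

open Matrix

/-- The multiplicative approximation `x ≈_α y` of real numbers: `x / α ≤ y ≤ α x`. -/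
def Approx (α x y : ℝ) : Prop :=
  (1 / α) * x ≤ y ∧ y ≤ α * x

/-- The multiplicative approximation `P ≈_α Q` of symmetric matrices in the Loewner order:
`P / α ⪯ Q ⪯ α P`. -/
def LoewnerApprox {d : ℕ} (α : ℝ) (P Q : Matrix (Fin d) (Fin d) ℝ) : Prop :=
  (Q - (1 / α) • P).PosSemidef ∧ (α • P - Q).PosSemidef

/-- The matrix `Aᵀ W ^ (1 - 2 / p) A`, where `W` is the diagonal matrix with diagonal `w`. -/
noncomputable def weightedGram {n d : ℕ} (A : Matrix (Fin n) (Fin d) ℝ) (p : ℝ) (w : Fin n → ℝ) :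
    Matrix (Fin d) (Fin d) ℝ :=
  Aᵀ * Matrix.diagonal (fun i => w i ^ (1 - 2 / p)) * A

/-- `w` satisfies the definition of the `ℓ_p` Lewis weights of `A`: the weights are nonnegative,
`Aᵀ W ^ (1 - 2 / p) A` is invertible and `aᵢᵀ (Aᵀ W ^ (1 - 2 / p) A)⁻¹ aᵢ = wᵢ ^ (2 / p)`
for every row `aᵢ` of `A`. -/
def IsLewisWeights {n d : ℕ} (A : Matrix (Fin n) (Fin d) ℝ) (p : ℝ) (w : Fin n → ℝ) : Prop :=
  (∀ i, 0 ≤ w i) ∧ IsUnit (weightedGram A p w).det ∧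
    ∀ i, A i ⬝ᵥ ((weightedGram A p w)⁻¹ *ᵥ A i) = w i ^ (2 / p)

/-- Feasibility of `M` for the determinant maximization program:
`M ⪰ 0` (in particular `M` is symmetric) and `∑ᵢ (aᵢᵀ M aᵢ) ^ (p / 2) ≤ d`. -/
def IsFeasible {n d : ℕ} (A : Matrix (Fin n) (Fin d) ℝ) (p : ℝ)
    (M : Matrix (Fin d) (Fin d) ℝ) : Prop :=
  M.PosSemidef ∧ ∑ i, (A i ⬝ᵥ (M *ᵥ A i)) ^ (p / 2) ≤ (d : ℝ)

/-- `Q` is the Lewis quadratic form: it maximizes the determinant over all feasible matrices. -/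
def IsLewisForm {n d : ℕ} (A : Matrix (Fin n) (Fin d) ℝ) (p : ℝ)
    (Q : Matrix (Fin d) (Fin d) ℝ) : Prop :=
  IsFeasible A p Q ∧ ∀ M, IsFeasible A p M → M.det ≤ Q.det

end LewisWeights

/-! ## Real RAM programs with a step count

A structured programming language for the unit-cost real RAM.  A program has finitely many
registers for natural numbers (counters and indices) and finitely many two-dimensional arrays of
real numbers, addressed by expressions in the natural number registers.  Arithmetic is exact. -/

namespace RealRAM

/-- The memory: natural number registers, and arrays of reals (array name, row, column). -/
structure State where
  nat : ℕ → ℕ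
  real : ℕ → ℕ → ℕ → ℝ

/-- Natural number expressions: constants, registers, sum and truncated difference. -/
inductive NExp where
  | const (k : ℕ) : NExp
  | reg (x : ℕ) : NExp
  | add (e₁ e₂ : NExp) : NExp
  | sub (e₁ e₂ : NExp) : NExp

/-- Real expressions: rational constants, conversion of natural numbers, array look-up,
the four arithmetic operations, and powers of a nonnegative base. There is no rounding of reals
to integers. -/
inductive RExp where
  | const (q : ℚ) : RExp
  | ofNat (e : NExp) : RExp
  | get (a : ℕ) (i j : NExp) : RExp
  | add (e₁ e₂ : RExp) : RExp
  | sub (e₁ e₂ : RExp) : RExp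
  | mul (e₁ e₂ : RExp) : RExp
  | div (e₁ e₂ : RExp) : RExp
  | pow (e₁ e₂ : RExp) : RExp

/-- Tests: comparisons of natural numbers and of reals, and their Boolean combinations. -/
inductive BExp where
  | natLe (e₁ e₂ : NExp) : BExp
  | realLe (e₁ e₂ : RExp) : BExp
  | neg (b : BExp) : BExp
  | conj (b₁ b₂ : BExp) : BExp

/-- Programs. `setNat x e` is the assignment `x := e` to a natural number register, and
`setReal a i j e` is the assignment `a[i, j] := e` to an array entry. -/
inductive Program where
  | skip : Program
  | setNat (x : ℕ) (e : NExp) : Program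
  | setReal (a : ℕ) (i j : NExp) (e : RExp) : Program
  | seq (P₁ P₂ : Program) : Program
  | cond (b : BExp) (P₁ P₂ : Program) : Program
  | loop (b : BExp) (P : Program) : Program

/-- The value of a natural number expression. -/
def NExp.eval (σ : State) : NExp → ℕ
  | .const k => k
  | .reg x => σ.nat x
  | .add e₁ e₂ => e₁.eval σ + e₂.eval σ
  | .sub e₁ e₂ => e₁.eval σ - e₂.eval σ

/-- The number of elementary operations in a natural number expression. -/
def NExp.cost : NExp → ℕ
  | .const _ => 1
  | .reg _ => 1
  | .add e₁ e₂ => e₁.cost + e₂.cost + 1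
  | .sub e₁ e₂ => e₁.cost + e₂.cost + 1

open Classical in
/-- The value of a real expression. Division by zero returns `0`, and so does a power with a
negative base. -/
noncomputable def RExp.eval (σ : State) : RExp → ℝ
  | .const q => (q : ℝ)
  | .ofNat e => (e.eval σ : ℝ)
  | .get a i j => σ.real a (i.eval σ) (j.eval σ)
  | .add e₁ e₂ => e₁.eval σ + e₂.eval σ
  | .sub e₁ e₂ => e₁.eval σ - e₂.eval σ
  | .mul e₁ e₂ => e₁.eval σ * e₂.eval σ
  | .div e₁ e₂ => e₁.eval σ / e₂.eval σ
  | .pow e₁ e₂ => if 0 ≤ e₁.eval σ then e₁.eval σ ^ e₂.eval σ else 0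

/-- The number of elementary operations in a real expression. -/
def RExp.cost : RExp → ℕ
  | .const _ => 1
  | .ofNat e => e.cost + 1
  | .get _ i j => i.cost + j.cost + 1
  | .add e₁ e₂ => e₁.cost + e₂.cost + 1
  | .sub e₁ e₂ => e₁.cost + e₂.cost + 1
  | .mul e₁ e₂ => e₁.cost + e₂.cost + 1
  | .div e₁ e₂ => e₁.cost + e₂.cost + 1
  | .pow e₁ e₂ => e₁.cost + e₂.cost + 1

/-- The truth value of a test. -/
def BExp.eval (σ : State) : BExp → Prop
  | .natLe e₁ e₂ => e₁.eval σ ≤ e₂.eval σ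
  | .realLe e₁ e₂ => e₁.eval σ ≤ e₂.eval σ
  | .neg b => ¬ b.eval σ
  | .conj b₁ b₂ => b₁.eval σ ∧ b₂.eval σ

/-- The number of elementary operations in a test. -/
def BExp.cost : BExp → ℕ
  | .natLe e₁ e₂ => e₁.cost + e₂.cost + 1
  | .realLe e₁ e₂ => e₁.cost + e₂.cost + 1
  | .neg b => b.cost + 1
  | .conj b₁ b₂ => b₁.cost + b₂.cost + 1

/-- Overwrite a natural number register. -/
def State.setNat (σ : State) (x k : ℕ) : State where
  nat := Function.update σ.nat x k
  real := σ.real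

/-- Overwrite an array entry. -/
noncomputable def State.setReal (σ : State) (a i j : ℕ) (v : ℝ) : State where
  nat := σ.nat
  real := Function.update σ.real a
    (Function.update (σ.real a) i (Function.update (σ.real a i) j v))

/-- `Runs P σ t τ`: started in the memory `σ`, the program `P` halts after `t` elementary steps
in the memory `τ`. Every evaluation of an expression or a test is charged its number of
operations, and every assignment and every branching is charged one more step. -/
inductive Runs : Program → State → ℕ → State → Prop where
  | skip (σ : State) : Runs .skip σ 1 σ
  | setNat (σ : State) (x : ℕ) (e : NExp) :
      Runs (.setNat x e) σ (e.cost + 1) (σ.setNat x (e.eval σ))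
  | setReal (σ : State) (a : ℕ) (i j : NExp) (e : RExp) :
      Runs (.setReal a i j e) σ (i.cost + j.cost + e.cost + 1)
        (σ.setReal a (i.eval σ) (j.eval σ) (e.eval σ))
  | seq {P₁ P₂ : Program} {σ₁ σ₂ σ₃ : State} {t₁ t₂ : ℕ} (h₁ : Runs P₁ σ₁ t₁ σ₂)
      (h₂ : Runs P₂ σ₂ t₂ σ₃) : Runs (.seq P₁ P₂) σ₁ (t₁ + t₂) σ₃
  | condTrue {b : BExp} {P₁ P₂ : Program} {σ τ : State} {t : ℕ} (hb : b.eval σ)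
      (h : Runs P₁ σ t τ) : Runs (.cond b P₁ P₂) σ (b.cost + 1 + t) τ
  | condFalse {b : BExp} {P₁ P₂ : Program} {σ τ : State} {t : ℕ} (hb : ¬ b.eval σ)
      (h : Runs P₂ σ t τ) : Runs (.cond b P₁ P₂) σ (b.cost + 1 + t) τ
  | loopTrue {b : BExp} {P : Program} {σ₁ σ₂ σ₃ : State} {t₁ t₂ : ℕ} (hb : b.eval σ₁)
      (h₁ : Runs P σ₁ t₁ σ₂) (h₂ : Runs (.loop b P) σ₂ t₂ σ₃) :
      Runs (.loop b P) σ₁ (b.cost + 1 + t₁ + t₂) σ₃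
  | loopFalse {b : BExp} {P : Program} {σ : State} (hb : ¬ b.eval σ) :
      Runs (.loop b P) σ (b.cost + 1) σ

/-- The initial memory for an `n × d` matrix `A` and real parameters `p`, `ε`: registers `0` and
`1` hold `n` and `d`, array `0` holds `A`, the entries `[0, 0]` of arrays `1` and `2` hold `p` and
`ε`, and everything else is zero. -/
noncomputable def input {n d : ℕ} (A : Matrix (Fin n) (Fin d) ℝ) (p ε : ℝ) : State where
  nat := fun x => if x = 0 then n else if x = 1 then d else 0
  real := fun a i j =>
    if a = 0 then (if h : i < n ∧ j < d then A ⟨i, h.1⟩ ⟨j, h.2⟩ else 0)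
    else if a = 1 ∧ i = 0 ∧ j = 0 then p
    else if a = 2 ∧ i = 0 ∧ j = 0 then ε
    else 0

/-- The output vector: column `0` of array `3`. -/
def outputVector (τ : State) (n : ℕ) : Fin n → ℝ :=
  fun i => τ.real 3 i 0

/-- The output matrix: array `4`. -/
def outputMatrix (τ : State) (d : ℕ) : Matrix (Fin d) (Fin d) ℝ :=
  Matrix.of fun i j => τ.real 4 i j

end RealRAM

namespace LewisWeights

open Matrix Filter Topology

/-! ### Positive definite matrices -/

section PosDef

variable {κ : Type*} [Fintype κ]

/-! Existence comes from compactness and first order optimality. The feasible set is compact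
(`isCompact_isFeasible`), so a determinant maximizer `Q` exists. Testing it against rank one
perturbations rescaled to feasibility identifies `Q⁻¹` as a Gram matrix weighted by `(aᵢᵀ Q aᵢ) ^ (p
/ 2 - 1)` (`IsLewisForm.inv_eq_gram`), which is the Lewis equation.

Uniqueness and accuracy both rest on weak duality (`trace_weightedGram_mul_le`): nonnegative weights
of total at most `d` and a feasible `M` satisfy `tr (Aᵀ W ^ (1 - 2 / p) A M) ≤ d`, by weighted
AM-GM. If `X` and `Q` satisfy `tr (X Q) ≤ d` and `tr (X⁻¹ Q⁻¹) ≤ d + θ`, simultaneous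
diagonalization gives positive `μᵢ` with `∑ (μᵢ + 1 / μᵢ - 2) ≤ θ`. Every summand is nonnegative, so
every `μᵢ` is close to `1` (`loewnerApprox_inv_of_trace_le`); `θ = 0` gives uniqueness.

The algorithm repeatedly replaces the weights by the leverage scores of the reweighted matrix,
starting from `d / n`, and averages the Gram matrices of `T` rounds into `X`. Convexity of `X ↦ log
(aᵀ X⁻¹ a)` makes the logarithms of successive weights telescope (`log_quad_averageGram_le`), with
error `δ = log n / T`. Hence `X⁻¹` is feasible after scaling by `exp (-(1 - 2 / p) δ)`, while weak
duality passes to averages without loss. The two trace bounds hold with `θ = 2 d δ` once `δ ≤ 1`, so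
a number of rounds proportional to `d log n` suffices for fixed `p` and `ε`. This convergence
argument covers every `p ≥ 2`.

One round costs `O(n d ^ 3)` machine steps: Gram matrix, pivot-free inversion by symmetric rank one
corrections (`IsPartialInverse.step`), quadratic forms and reweighting. -/

open scoped MatrixOrder ComplexOrder in
theorem exists_transpose_mul_self [DecidableEq κ] {M : Matrix κ κ ℝ} (hM : M.PosSemidef) :
    ∃ B : Matrix κ κ ℝ, M = Bᵀ * B := by
  obtain ⟨B, hB⟩ := CStarAlgebra.nonneg_iff_eq_star_mul_self.mp hM.nonneg
  exact ⟨B, by rw [hB, star_eq_conjTranspose, conjTranspose_eq_transpose_of_trivial]⟩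

open scoped MatrixOrder ComplexOrder in
theorem posDef_of_det_pos [DecidableEq κ] {M : Matrix κ κ ℝ} (hM : M.PosSemidef) (h : 0 < M.det) : M.PosDef :=
  hM.posDef_iff_det_ne_zero.mpr h.ne'

theorem posSemidef_of_quad_nonneg {M : Matrix κ κ ℝ} (hM : Mᵀ = M)
    (h : ∀ x, 0 ≤ x ⬝ᵥ M *ᵥ x) : M.PosSemidef :=
  .of_dotProduct_mulVec_nonneg (by simpa [IsHermitian] using hM) (by simpa using h)

theorem quad_nonneg {M : Matrix κ κ ℝ} (hM : M.PosSemidef) (x : κ → ℝ) : 0 ≤ x ⬝ᵥ M *ᵥ x := by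
  simpa using hM.dotProduct_mulVec_nonneg x

theorem quad_pos {M : Matrix κ κ ℝ} (hM : M.PosDef) {x : κ → ℝ} (hx : x ≠ 0) :
    0 < x ⬝ᵥ M *ᵥ x := by
  simpa using hM.dotProduct_mulVec_pos hx

theorem isSymm_of_posSemidef {κ : Type*} {M : Matrix κ κ ℝ} (hM : M.PosSemidef) : Mᵀ = M := by
  simpa [IsHermitian] using hM.1

theorem isUnit_det_of_posDef [DecidableEq κ] {M : Matrix κ κ ℝ} (hM : M.PosDef) : IsUnit M.det :=
  hM.det_pos.ne'.isUnit

theorem dotProduct_mulVec_symm {M : Matrix κ κ ℝ} (hM : Mᵀ = M) (x y : κ → ℝ) :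
    x ⬝ᵥ M *ᵥ y = y ⬝ᵥ M *ᵥ x := by
  rw [dotProduct_mulVec, ← mulVec_transpose, hM, dotProduct_comm]

/-- Spectral decomposition of a real symmetric matrix. -/
theorem exists_orthogonal_diagonal [DecidableEq κ] {M : Matrix κ κ ℝ} (hM : Mᵀ = M) :
    ∃ (U : Matrix κ κ ℝ) (μ : κ → ℝ), Uᵀ * U = 1 ∧ U * Uᵀ = 1 ∧ M = U * diagonal μ * Uᵀ := by
  have hH : M.IsHermitian := by simpa [IsHermitian] using hM
  refine ⟨hH.eigenvectorUnitary, hH.eigenvalues, ?_, ?_, ?_⟩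
  · simpa [star_eq_conjTranspose] using Unitary.coe_star_mul_self hH.eigenvectorUnitary
  · simpa [star_eq_conjTranspose] using Unitary.coe_mul_star_self hH.eigenvectorUnitary
  · conv_lhs => rw [hH.spectral_theorem]
    simp [Unitary.conjStarAlgAut_apply, star_eq_conjTranspose]

/-- Simultaneous diagonalization of two positive definite matrices. -/
theorem exists_simultaneous_diagonal [DecidableEq κ] {X Q : Matrix κ κ ℝ} (hX : X.PosDef) (hQ : Q.PosDef) :
    ∃ (C : Matrix κ κ ℝ) (μ : κ → ℝ), (∀ i, 0 < μ i) ∧ Q = Cᵀ * C ∧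
      X⁻¹ = Cᵀ * diagonal (fun i => (μ i)⁻¹) * C ∧ (X * Q).trace = ∑ i, μ i ∧
      (X⁻¹ * Q⁻¹).trace = ∑ i, (μ i)⁻¹ := by
  obtain ⟨B, hB⟩ := exists_transpose_mul_self hQ.posSemidef
  have hBu : IsUnit B.det := by
    have := isUnit_det_of_posDef hQ
    rw [hB, det_mul] at this
    exact isUnit_of_mul_isUnit_right this
  have hBX : (B * X * Bᵀ)ᵀ = B * X * Bᵀ := by
    simp [transpose_mul, isSymm_of_posSemidef hX.posSemidef, Matrix.mul_assoc]
  obtain ⟨U, μ, hU, hU', hμ⟩ := exists_orthogonal_diagonal hBX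
  have hUt : Uᵀ⁻¹ = U := inv_eq_left_inv hU'
  have hUi : U⁻¹ = Uᵀ := inv_eq_left_inv hU
  set C := Uᵀ * B with hC
  have hCu : IsUnit C.det := by
    rw [hC, det_mul]
    exact (isUnit_det_of_left_inverse hU').mul hBu
  have hCX : C * X * Cᵀ = diagonal μ := by
    have : C * X * Cᵀ = Uᵀ * (B * X * Bᵀ) * U := by
      simp [hC, transpose_mul, Matrix.mul_assoc]
    rw [this, hμ]
    calc Uᵀ * (U * diagonal μ * Uᵀ) * U = (Uᵀ * U) * diagonal μ * (Uᵀ * U) := by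
          simp only [Matrix.mul_assoc]
      _ = _ := by simp [hU]
  have hQC : Q = Cᵀ * C := by
    rw [hB, hC, transpose_mul, transpose_transpose]
    calc Bᵀ * B = Bᵀ * (U * Uᵀ) * B := by simp [hU']
      _ = _ := by simp only [Matrix.mul_assoc]
  have hpos : ∀ i, 0 < μ i := by
    intro i
    have h1 : μ i = (Pi.single i 1 : κ → ℝ) ⬝ᵥ (C * X * Cᵀ) *ᵥ Pi.single i 1 := by
      rw [hCX]; simp
    rw [h1, ← mulVec_mulVec, ← mulVec_mulVec, dotProduct_mulVec, ← mulVec_transpose]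
    apply quad_pos hX
    intro h
    have := congrArg (fun v => Cᵀ⁻¹ *ᵥ v) h
    simp only [mulVec_mulVec, nonsing_inv_mul _ (isUnit_det_transpose C hCu)] at this
    simpa using congrFun this i
  have hXinv : X⁻¹ = Cᵀ * diagonal (fun i => (μ i)⁻¹) * C := by
    apply inv_eq_left_inv
    have h2 : C * X = diagonal μ * Cᵀ⁻¹ := by
      rw [← hCX, mul_nonsing_inv_cancel_right _ _ (isUnit_det_transpose C hCu)]
    calc Cᵀ * diagonal (fun i => (μ i)⁻¹) * C * X
        = Cᵀ * (diagonal (fun i => (μ i)⁻¹) * diagonal μ) * Cᵀ⁻¹ := by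
          rw [Matrix.mul_assoc _ C X, h2]; simp only [Matrix.mul_assoc]
      _ = 1 := by
          rw [diagonal_mul_diagonal]
          simp [fun i => inv_mul_cancel₀ (hpos i).ne',
            mul_nonsing_inv _ (isUnit_det_transpose C hCu)]
  refine ⟨C, μ, hpos, hQC, hXinv, ?_, ?_⟩
  · rw [hQC, ← Matrix.mul_assoc, Matrix.trace_mul_comm, ← Matrix.mul_assoc, hCX, trace_diagonal]
  · rw [hXinv, hQC, Matrix.mul_inv_rev, Matrix.mul_assoc, mul_nonsing_inv_cancel_left _ _ hCu,
      Matrix.trace_mul_comm, nonsing_inv_mul_cancel_left _ _ (isUnit_det_transpose C hCu),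
      trace_diagonal]

/-! ### Closeness and equality of positive definite forms from trace bounds -/

/-- Multiplied by `μ * β`, the hypothesis becomes `(μ - β) * (μ * β - 1) ≤ 0`, and `1 ≤ β` decides
which factor has which sign. -/
theorem le_of_add_inv_le {β μ : ℝ} (hβ : 1 ≤ β) (hμ : 0 < μ) (h : μ + μ⁻¹ ≤ β + β⁻¹) :
    μ ≤ β ∧ β⁻¹ ≤ μ := by
  have hβ0 : 0 < β := by linarith
  have key : (μ - β) * (μ * β - 1) ≤ 0 := by
    have : (μ - β) * (μ * β - 1) = (μ + μ⁻¹ - (β + β⁻¹)) * (μ * β) := by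
      field_simp; ring
    rw [this]
    exact mul_nonpos_of_nonpos_of_nonneg (by linarith) (by positivity)
  constructor
  · by_contra hlt
    push Not at hlt
    nlinarith [mul_pos (sub_pos.mpr hlt) (show 0 < μ * β - 1 by nlinarith)]
  · rw [inv_le_iff_one_le_mul₀ hβ0]
    by_contra hlt
    push Not at hlt
    have : μ < β := by nlinarith
    nlinarith [mul_pos (sub_pos.mpr this) (sub_pos.mpr hlt)]

/-- In a common diagonalizing frame the traces are `∑ μᵢ` and `∑ 1 / μᵢ`. Their sum exceeds its
minimum `2 d` by at most `θ`, and this excess is a sum of nonnegative terms, so it bounds each of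
them. -/
theorem loewnerApprox_inv_of_trace_le {d : ℕ} {X Q : Matrix (Fin d) (Fin d) ℝ} {β θ : ℝ}
    (hX : X.PosDef) (hQ : Q.PosDef) (h₁ : (X * Q).trace ≤ d) (h₂ : (X⁻¹ * Q⁻¹).trace ≤ d + θ)
    (hβ : 1 ≤ β) (hθ : θ ≤ β + β⁻¹ - 2) : LoewnerApprox β X⁻¹ Q := by
  obtain ⟨C, μ, hμ, hQC, hXC, ht, ht'⟩ := exists_simultaneous_diagonal hX hQ
  have hterm : ∀ i, μ i + (μ i)⁻¹ ≤ β + β⁻¹ := by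
    intro i
    have hnn : ∀ j, 0 ≤ μ j + (μ j)⁻¹ - 2 := fun j => by
      have : μ j + (μ j)⁻¹ - 2 = (μ j - 1) ^ 2 / μ j := by
        have := (hμ j).ne'
        field_simp; ring
      rw [this]; have := hμ j; positivity
    have h1 := Finset.single_le_sum (f := fun j => μ j + (μ j)⁻¹ - 2) (fun j _ => hnn j)
      (Finset.mem_univ i)
    simp only [Finset.sum_sub_distrib, Finset.sum_add_distrib, Finset.sum_const,
      Finset.card_univ, Fintype.card_fin, nsmul_eq_mul] at h1
    linarith
  have hb : ∀ i, μ i ≤ β ∧ β⁻¹ ≤ μ i := fun i => le_of_add_inv_le hβ (hμ i) (hterm i)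
  have psd : ∀ v : Fin d → ℝ, 0 ≤ v → (Cᵀ * diagonal v * C).PosSemidef := fun v hv => by
    simpa using (PosSemidef.diagonal hv).conjTranspose_mul_mul_same C
  have hβ0 : 0 < β := by linarith
  constructor
  · have : Q - (1 / β) • X⁻¹ = Cᵀ * diagonal (fun i => 1 - β⁻¹ * (μ i)⁻¹) * C := by
      rw [hQC, hXC, ← diagonal_sub, diagonal_one]
      simp only [Matrix.mul_sub, Matrix.sub_mul, Matrix.mul_one, one_div]
      congr 1
      rw [← Matrix.smul_mul, ← Matrix.mul_smul, ← diagonal_smul]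
      rfl
    rw [this]
    refine psd _ fun i => ?_
    have := (hb i).2
    have : β⁻¹ * (μ i)⁻¹ ≤ 1 := by
      rw [← div_eq_mul_inv, div_le_one (hμ i)]; exact this
    simpa using this
  · have : β • X⁻¹ - Q = Cᵀ * diagonal (fun i => β * (μ i)⁻¹ - 1) * C := by
      rw [hQC, hXC, ← diagonal_sub, diagonal_one]
      simp only [Matrix.mul_sub, Matrix.sub_mul, Matrix.mul_one]
      congr 1
      rw [← Matrix.smul_mul, ← Matrix.mul_smul, ← diagonal_smul]
      rfl
    rw [this]
    refine psd _ fun i => ?_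
    have : 1 ≤ β * (μ i)⁻¹ := by
      rw [← div_eq_mul_inv, one_le_div (hμ i)]; exact (hb i).1
    simpa using this

theorem eq_zero_of_posSemidef_neg {Z : Matrix κ κ ℝ} (h : Z.PosSemidef) (h' : (-Z).PosSemidef) :
    Z = 0 := by
  rw [← h.trace_eq_zero_iff]
  have h1 := h.trace_nonneg
  have h2 := h'.trace_nonneg
  rw [trace_neg] at h2
  linarith

/-- The equality case, with no excess to distribute; it turns weak duality into uniqueness. -/
theorem eq_inv_of_trace_le {d : ℕ} {X Q : Matrix (Fin d) (Fin d) ℝ}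
    (hX : X.PosDef) (hQ : Q.PosDef) (h₁ : (X * Q).trace ≤ d) (h₂ : (X⁻¹ * Q⁻¹).trace ≤ d) :
    Q = X⁻¹ := by
  have h := loewnerApprox_inv_of_trace_le (θ := 0) (β := 1) hX hQ h₁ (by simpa using h₂) le_rfl
    (by norm_num)
  simp only [LoewnerApprox, one_div, inv_one, one_smul] at h
  exact sub_eq_zero.mp (eq_zero_of_posSemidef_neg h.1 (by simpa using h.2))

/-- Writing `Q = Bᵀ B`, the trace is that of the positive semidefinite matrix `B Z Bᵀ`, and `B` is
invertible. -/
theorem eq_zero_of_trace_mul_posDef [DecidableEq κ] {Z Q : Matrix κ κ ℝ} (hZ : Z.PosSemidef) (hQ : Q.PosDef)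
    (h : (Z * Q).trace = 0) : Z = 0 := by
  obtain ⟨B, hB⟩ := exists_transpose_mul_self hQ.posSemidef
  have hBu : IsUnit B.det := by
    have := isUnit_det_of_posDef hQ
    rw [hB, det_mul] at this
    exact isUnit_of_mul_isUnit_right this
  have hBZ : (B * Z * Bᵀ).PosSemidef := by
    simpa using hZ.mul_mul_conjTranspose_same B
  have h0 : B * Z * Bᵀ = 0 := by
    rw [← hBZ.trace_eq_zero_iff, Matrix.trace_mul_comm, ← Matrix.mul_assoc, ← hB,
      Matrix.trace_mul_comm, h]
  calc Z = B⁻¹ * (B * Z * Bᵀ) * Bᵀ⁻¹ := by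
        rw [Matrix.mul_assoc B, nonsing_inv_mul_cancel_left _ _ hBu,
          mul_nonsing_inv_cancel_right _ _ (isUnit_det_transpose B hBu)]
    _ = 0 := by rw [h0]; simp

theorem det_add_smul_vecMulVec [DecidableEq κ] {Q : Matrix κ κ ℝ} (hQ : IsUnit Q.det) (t : ℝ) (y : κ → ℝ) :
    (Q + t • vecMulVec y y).det = Q.det * (1 + t * (y ⬝ᵥ Q⁻¹ *ᵥ y)) := by
  have h := det_add_replicateCol_mul_replicateRow (ι := Unit) hQ (t • y) y
  have e : replicateCol Unit (t • y) * replicateRow Unit y = t • vecMulVec y y := by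
    rw [← vecMulVec_eq, smul_vecMulVec]
  rw [e] at h
  rw [h]
  congr 1
  rw [det_unique, Matrix.add_apply, one_apply_eq, Matrix.mul_assoc,
    ← replicateCol_mulVec, Matrix.replicateRow_mul_replicateCol_apply]
  simp [mulVec_smul]

/-- The Cauchy-Schwarz inequality for a positive definite form and its inverse. -/
theorem sq_dotProduct_le [DecidableEq κ] {X : Matrix κ κ ℝ} (hX : X.PosDef) (a y : κ → ℝ) :
    (a ⬝ᵥ y) ^ 2 ≤ (a ⬝ᵥ X⁻¹ *ᵥ a) * (y ⬝ᵥ X *ᵥ y) := by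
  have hs : Xᵀ = X := isSymm_of_posSemidef hX.posSemidef
  set b := X⁻¹ *ᵥ a with hb
  have hXb : X *ᵥ b = a := by
    rw [hb, mulVec_mulVec, mul_nonsing_inv _ (isUnit_det_of_posDef hX), one_mulVec]
  -- This quadratic in `t` is the form `X` evaluated at `b - t • y`; its discriminant is therefore
  -- nonpositive.
  have h1 : ∀ t : ℝ, 0 ≤ (y ⬝ᵥ X *ᵥ y) * (t * t) + (-2 * (a ⬝ᵥ y)) * t + a ⬝ᵥ b := by
    intro t
    have := quad_nonneg hX.posSemidef (b - t • y)
    rw [mulVec_sub, mulVec_smul, hXb, sub_dotProduct, dotProduct_sub, dotProduct_sub,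
      smul_dotProduct, smul_dotProduct, dotProduct_smul, dotProduct_smul,
      dotProduct_mulVec_symm hs b y, hXb, dotProduct_comm b a, dotProduct_comm y a] at this
    simp only [smul_eq_mul] at this
    linarith
  have h2 := discrim_le_zero h1
  rw [discrim] at h2
  linarith

end PosDef

end LewisWeights

namespace LewisWeights

open Matrix Filter Topology

/-! ### Weighted Gram matrices -/

section Gram

variable {n d : ℕ}

/-- The matrix `Aᵀ diag(v) A`. -/
def gram (A : Matrix (Fin n) (Fin d) ℝ) (v : Fin n → ℝ) : Matrix (Fin d) (Fin d) ℝ :=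
  Aᵀ * diagonal v * A

theorem weightedGram_eq_gram (A : Matrix (Fin n) (Fin d) ℝ) (p : ℝ) (w : Fin n → ℝ) :
    weightedGram A p w = gram A (fun i => w i ^ (1 - 2 / p)) := rfl

theorem gram_apply (A : Matrix (Fin n) (Fin d) ℝ) (v : Fin n → ℝ) (j k : Fin d) :
    gram A v j k = ∑ i, v i * A i j * A i k := by
  rw [gram, mul_apply]
  simp only [mul_diagonal, transpose_apply]
  exact Finset.sum_congr rfl fun i _ => by ring

theorem gram_transpose (A : Matrix (Fin n) (Fin d) ℝ) (v : Fin n → ℝ) :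
    (gram A v)ᵀ = gram A v := by
  simp [gram, transpose_mul, Matrix.mul_assoc]

theorem mul_mul_transpose_apply_self (A : Matrix (Fin n) (Fin d) ℝ)
    (M : Matrix (Fin d) (Fin d) ℝ) (i : Fin n) : (A * M * Aᵀ) i i = A i ⬝ᵥ M *ᵥ A i := by
  rw [Matrix.mul_assoc, mul_apply_eq_vecMul, ← dotProduct_comm]
  simp [dotProduct, vecMul, mulVec, mul_apply, mul_comm]

theorem trace_gram_mul (A : Matrix (Fin n) (Fin d) ℝ) (v : Fin n → ℝ)
    (M : Matrix (Fin d) (Fin d) ℝ) :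
    (gram A v * M).trace = ∑ i, v i * (A i ⬝ᵥ M *ᵥ A i) := by
  rw [gram, Matrix.mul_assoc, Matrix.mul_assoc, Matrix.trace_mul_comm, Matrix.mul_assoc, trace]
  refine Finset.sum_congr rfl fun i _ => ?_
  rw [diag_apply, diagonal_mul, mul_mul_transpose_apply_self]

theorem quad_gram (A : Matrix (Fin n) (Fin d) ℝ) (v : Fin n → ℝ) (x : Fin d → ℝ) :
    x ⬝ᵥ gram A v *ᵥ x = ∑ i, v i * (A i ⬝ᵥ x) ^ 2 := by
  rw [gram, ← mulVec_mulVec, ← mulVec_mulVec, dotProduct_mulVec, vecMul_transpose, dotProduct]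
  refine Finset.sum_congr rfl fun i _ => ?_
  rw [mulVec_diagonal]
  simp only [mulVec]
  ring

theorem gram_posSemidef (A : Matrix (Fin n) (Fin d) ℝ) {v : Fin n → ℝ} (hv : ∀ i, 0 ≤ v i) :
    (gram A v).PosSemidef :=
  posSemidef_of_quad_nonneg (gram_transpose A v) fun x => by
    rw [quad_gram]
    exact Finset.sum_nonneg fun i _ => mul_nonneg (hv i) (sq_nonneg _)

theorem mulVec_ne_zero_of_rank {A : Matrix (Fin n) (Fin d) ℝ} (hA : A.rank = d) {x : Fin d → ℝ}
    (hx : x ≠ 0) : A *ᵥ x ≠ 0 := by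
  have h1 := LinearMap.finrank_range_add_finrank_ker A.mulVecLin
  have h2 : Module.finrank ℝ A.mulVecLin.range = d := hA
  rw [h2, Module.finrank_fin_fun] at h1
  have h3 : A.mulVecLin.ker = ⊥ := Submodule.finrank_eq_zero.mp (by omega)
  intro h
  exact hx (LinearMap.ker_eq_bot'.mp h3 x h)

/-- Zero rows contribute nothing, so their weights may vanish; positivity on the nonzero rows is the
condition that the iteration preserves. -/
theorem gram_posDef {A : Matrix (Fin n) (Fin d) ℝ} (hA : A.rank = d) {v : Fin n → ℝ}
    (hv : ∀ i, 0 ≤ v i) (hv' : ∀ i, A i ≠ 0 → 0 < v i) : (gram A v).PosDef := by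
  refine .of_dotProduct_mulVec_pos (gram_posSemidef A hv).1 fun x hx => ?_
  rw [star_trivial, quad_gram]
  obtain ⟨i, hi⟩ := Function.ne_iff.mp (mulVec_ne_zero_of_rank hA hx)
  have hi' : A i ⬝ᵥ x ≠ 0 := hi
  have hAi : A i ≠ 0 := fun h => hi' (by rw [h, zero_dotProduct])
  refine Finset.sum_pos' (fun i _ => mul_nonneg (hv i) (sq_nonneg _)) ⟨i, Finset.mem_univ _, ?_⟩
  have := hv' i hAi
  positivity

/-- Serves to recover `M` from `A M Aᵀ` in the compactness argument. -/
theorem exists_left_inverse {A : Matrix (Fin n) (Fin d) ℝ} (hA : A.rank = d) :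
    ∃ L : Matrix (Fin d) (Fin n) ℝ, L * A = 1 := by
  have h := gram_posDef hA (v := fun _ => 1) (fun _ => zero_le_one) (fun _ _ => one_pos)
  refine ⟨(gram A fun _ => 1)⁻¹ * Aᵀ, ?_⟩
  have e : gram A (fun _ => 1) = Aᵀ * A := by simp [gram]
  rw [Matrix.mul_assoc, ← e, nonsing_inv_mul _ (isUnit_det_of_posDef h)]

end Gram

/-! ### Feasible matrices -/

section Feasible

variable {n d : ℕ} {A : Matrix (Fin n) (Fin d) ℝ} {p : ℝ}

theorem one_sub_two_div_nonneg (hp : 2 ≤ p) : 0 ≤ 1 - 2 / p := by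
  rw [sub_nonneg, div_le_one (by linarith)]; exact hp

/-- Weighted AM-GM for `w` and `τ ^ (p / 2)` with weights `1 - 2 / p` and `2 / p`; summed over the
rows it becomes weak duality. -/
theorem rpow_mul_le (hp : 2 ≤ p) {w τ : ℝ} (hw : 0 ≤ w) (hτ : 0 ≤ τ) :
    w ^ (1 - 2 / p) * τ ≤ (1 - 2 / p) * w + 2 / p * τ ^ (p / 2) := by
  have hp0 : 0 < p := by linarith
  have h := Real.geom_mean_le_arith_mean2_weighted (one_sub_two_div_nonneg hp)
    (div_nonneg zero_le_two hp0.le) hw (Real.rpow_nonneg hτ (p / 2)) (by ring)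
  rwa [← Real.rpow_mul hτ, show p / 2 * (2 / p) = 1 by field_simp, Real.rpow_one] at h

/-- Weak duality. -/
theorem trace_weightedGram_mul_le (hp : 2 ≤ p) {w : Fin n → ℝ} (hw : ∀ i, 0 ≤ w i)
    (hsum : ∑ i, w i ≤ d) {M : Matrix (Fin d) (Fin d) ℝ} (hM : IsFeasible A p M) :
    (weightedGram A p w * M).trace ≤ d := by
  rw [weightedGram_eq_gram, trace_gram_mul]
  calc ∑ i, w i ^ (1 - 2 / p) * (A i ⬝ᵥ M *ᵥ A i)
      ≤ ∑ i, ((1 - 2 / p) * w i + 2 / p * (A i ⬝ᵥ M *ᵥ A i) ^ (p / 2)) :=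
        Finset.sum_le_sum fun i _ => rpow_mul_le hp (hw i) (quad_nonneg hM.1 _)
    _ = (1 - 2 / p) * ∑ i, w i + 2 / p * ∑ i, (A i ⬝ᵥ M *ᵥ A i) ^ (p / 2) := by
        rw [Finset.sum_add_distrib, Finset.mul_sum, Finset.mul_sum]
    _ ≤ (1 - 2 / p) * d + 2 / p * d :=
        add_le_add (mul_le_mul_of_nonneg_left hsum (one_sub_two_div_nonneg hp))
          (mul_le_mul_of_nonneg_left hM.2 (by positivity))
    _ = d := by ring

theorem sum_smul_rpow {M : Matrix (Fin d) (Fin d) ℝ} (hM : M.PosSemidef) {s : ℝ} (hs : 0 ≤ s) :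
    ∑ i, (A i ⬝ᵥ (s • M) *ᵥ A i) ^ (p / 2) =
      s ^ (p / 2) * ∑ i, (A i ⬝ᵥ M *ᵥ A i) ^ (p / 2) := by
  rw [Finset.mul_sum]
  refine Finset.sum_congr rfl fun i _ => ?_
  rw [smul_mulVec, dotProduct_smul, smul_eq_mul, Real.mul_rpow hs (quad_nonneg hM _)]

theorem isFeasible_smul {M : Matrix (Fin d) (Fin d) ℝ} (hM : M.PosSemidef) {s : ℝ} (hs : 0 ≤ s)
    (h : s ^ (p / 2) * ∑ i, (A i ⬝ᵥ M *ᵥ A i) ^ (p / 2) ≤ d) : IsFeasible A p (s • M) :=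
  ⟨hM.smul hs, by rwa [sum_smul_rpow hM hs]⟩

theorem exists_smul_isFeasible (hd : 0 < d) (hp : 2 ≤ p) {M : Matrix (Fin d) (Fin d) ℝ}
    (hM : M.PosSemidef) : ∃ s : ℝ, 0 < s ∧ IsFeasible A p (s • M) := by
  have hp0 : 0 < p := by linarith
  have hd' : (0 : ℝ) < d := by exact_mod_cast hd
  set g := ∑ i, (A i ⬝ᵥ M *ᵥ A i) ^ (p / 2)
  -- The sum `g` may vanish, for instance at `M = 0`, so the scaling divides by `max g 1`.
  have hg : 0 < max g 1 := by positivity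
  have hs : 0 < (d / max g 1 : ℝ) := by positivity
  refine ⟨(d / max g 1 : ℝ) ^ (2 / p), Real.rpow_pos_of_pos hs _,
    isFeasible_smul hM (Real.rpow_nonneg hs.le _) ?_⟩
  rw [← Real.rpow_mul hs.le, show 2 / p * (p / 2) = 1 by field_simp, Real.rpow_one]
  calc d / max g 1 * g ≤ d / max g 1 * max g 1 :=
        mul_le_mul_of_nonneg_left (le_max_left _ _) hs.le
    _ = d := by field_simp

/-- As `d ≥ 1` and `p / 2 ≥ 1`, a value above `d` would have a power above `d`, already violating
the constraint. -/
theorem quad_le_of_isFeasible (hd : 0 < d) (hp : 2 ≤ p) {M : Matrix (Fin d) (Fin d) ℝ}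
    (hM : IsFeasible A p M) (i : Fin n) : A i ⬝ᵥ M *ᵥ A i ≤ d := by
  have hd' : (1 : ℝ) ≤ d := by exact_mod_cast hd
  by_contra! h
  have h1 : (A i ⬝ᵥ M *ᵥ A i) ^ (1 : ℝ) ≤ (A i ⬝ᵥ M *ᵥ A i) ^ (p / 2) :=
    Real.rpow_le_rpow_of_exponent_le (hd'.trans h.le) (by linarith)
  have h2 := Finset.single_le_sum (f := fun i => (A i ⬝ᵥ M *ᵥ A i) ^ (p / 2))
    (fun i _ => Real.rpow_nonneg (quad_nonneg hM.1 _) _) (Finset.mem_univ i)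
  rw [Real.rpow_one] at h1
  have := hM.2
  linarith

/-- Testing positivity on `eᵢ ± eⱼ` bounds `2 |N i j|` by `N i i + N j j`. -/
theorem abs_apply_le_of_posSemidef {κ : Type*} [Fintype κ] [DecidableEq κ] {N : Matrix κ κ ℝ}
    (hN : N.PosSemidef) {b : ℝ} (hb : ∀ i, N i i ≤ b) (i j : κ) : |N i j| ≤ b := by
  have hs := isSymm_of_posSemidef hN
  have hsij : N j i = N i j := congrFun (congrFun hs i) j
  have e : ∀ c : ℝ, (Pi.single i 1 + c • Pi.single j 1 : κ → ℝ) ⬝ᵥ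
      N *ᵥ (Pi.single i 1 + c • Pi.single j 1) = N i i + 2 * c * N i j + c ^ 2 * N j j := by
    intro c
    simp [mulVec_add, mulVec_smul, add_dotProduct, dotProduct_add, hsij]
    ring
  have h1 := quad_nonneg hN (Pi.single i 1 + (1 : ℝ) • Pi.single j 1)
  have h2 := quad_nonneg hN (Pi.single i 1 + (-1 : ℝ) • Pi.single j 1)
  rw [e] at h1 h2
  have := hb i
  have := hb j
  rw [abs_le]
  constructor <;> linarith

theorem isClosed_isFeasible (hp : 2 ≤ p) : IsClosed {M | IsFeasible A p M} := by
  have hq : ∀ x : Fin d → ℝ, Continuous fun M : Matrix (Fin d) (Fin d) ℝ => x ⬝ᵥ M *ᵥ x :=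
    fun x => by fun_prop
  have e : {M | IsFeasible A p M} = {M | Mᵀ = M} ∩ (⋂ x, {M | 0 ≤ x ⬝ᵥ M *ᵥ x}) ∩
      {M | ∑ i, (A i ⬝ᵥ (M *ᵥ A i)) ^ (p / 2) ≤ (d : ℝ)} := by
    ext M
    simp only [Set.mem_inter_iff, Set.mem_iInter, Set.mem_ofPred_eq]
    exact ⟨fun h => ⟨⟨isSymm_of_posSemidef h.1, quad_nonneg h.1⟩, h.2⟩,
      fun h => ⟨posSemidef_of_quad_nonneg h.1.1 h.1.2, h.2⟩⟩
  rw [e]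
  refine (IsClosed.inter (isClosed_eq (by fun_prop) continuous_id)
    (isClosed_iInter fun x => isClosed_le continuous_const (hq x))).inter
    (isClosed_le (continuous_finsetSum _ fun i _ =>
      (hq (A i)).rpow_const fun _ => Or.inr (by linarith)) continuous_const)

/-- Feasibility bounds the diagonal of `A M Aᵀ`, hence all its entries, and a left inverse of `A`
recovers `M`. The feasible set is thus closed inside a continuous image of a cube. -/
theorem isCompact_isFeasible (hd : 0 < d) (hp : 2 ≤ p) (hA : A.rank = d) :
    IsCompact {M | IsFeasible A p M} := by
  obtain ⟨L, hL⟩ := exists_left_inverse hA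
  set B : Set (Matrix (Fin n) (Fin n) ℝ) :=
    Set.pi Set.univ fun _ => Set.pi Set.univ fun _ => Set.Icc (-(d : ℝ)) d
  have hB : IsCompact B :=
    isCompact_univ_pi fun _ => isCompact_univ_pi fun _ => isCompact_Icc
  have hf : Continuous fun N : Matrix (Fin n) (Fin n) ℝ => L * N * Lᵀ := by fun_prop
  refine (hB.image hf).of_isClosed_subset (isClosed_isFeasible hp) fun M hM => ?_
  refine ⟨A * M * Aᵀ, ?_, ?_⟩
  · have hpsd : (A * M * Aᵀ).PosSemidef := by simpa using hM.1.mul_mul_conjTranspose_same A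
    have hdiag : ∀ i, (A * M * Aᵀ) i i ≤ d := fun i => by
      rw [mul_mul_transpose_apply_self]
      exact quad_le_of_isFeasible hd hp hM i
    intro i _ j _
    exact abs_le.mp (abs_apply_le_of_posSemidef hpsd hdiag i j)
  · have hL' : Aᵀ * Lᵀ = 1 := by rw [← transpose_mul, hL, transpose_one]
    calc L * (A * M * Aᵀ) * Lᵀ = (L * A) * M * (Aᵀ * Lᵀ) := by simp only [Matrix.mul_assoc]
      _ = M := by simp [hL, hL']

theorem exists_isLewisForm (hd : 0 < d) (hp : 2 ≤ p) (hA : A.rank = d) :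
    ∃ Q, IsLewisForm A p Q := by
  obtain ⟨s, -, hs⟩ := exists_smul_isFeasible (A := A) hd hp (PosSemidef.one (n := Fin d) (R := ℝ))
  obtain ⟨Q, hQ, hmax⟩ := (isCompact_isFeasible hd hp hA).exists_isMaxOn ⟨_, hs⟩
    (f := fun M : Matrix (Fin d) (Fin d) ℝ => M.det) (by fun_prop)
  exact ⟨Q, hQ, fun M hM => hmax hM⟩

/-- Some positive multiple of the identity is feasible, so the maximal determinant is positive. -/
theorem IsLewisForm.posDef (hd : 0 < d) (hp : 2 ≤ p) {Q : Matrix (Fin d) (Fin d) ℝ}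
    (hQ : IsLewisForm A p Q) : Q.PosDef := by
  obtain ⟨s, hs0, hs⟩ :=
    exists_smul_isFeasible (A := A) hd hp (PosSemidef.one (n := Fin d) (R := ℝ))
  refine posDef_of_det_pos hQ.1.1 (lt_of_lt_of_le ?_ (hQ.2 _ hs))
  rw [det_smul, det_one, mul_one]
  positivity

end Feasible

/-! ### First order optimality -/

section Optimality

theorem deriv_nonneg_of_nonneg_right {h : ℝ → ℝ} {h' : ℝ} (hd : HasDerivAt h h' 0)
    (h0 : h 0 = 0) (hpos : ∀ t, 0 ≤ t → 0 ≤ h t) : 0 ≤ h' := by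
  have hs := (hasDerivWithinAt_iff_tendsto_slope' (s := Set.Ioi (0 : ℝ)) (by simp)).mp
    hd.hasDerivWithinAt
  refine ge_of_tendsto hs ?_
  filter_upwards [self_mem_nhdsWithin] with t ht
  have ht' : (0 : ℝ) < t := ht
  rw [slope_def_field, h0, sub_zero, sub_zero]
  exact div_nonneg (hpos t ht'.le) ht'.le

variable {n d : ℕ} {A : Matrix (Fin n) (Fin d) ℝ} {p : ℝ}

theorem quad_add_smul_vecMulVec (Q : Matrix (Fin d) (Fin d) ℝ) (t : ℝ) (a y : Fin d → ℝ) :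
    a ⬝ᵥ (Q + t • vecMulVec y y) *ᵥ a = a ⬝ᵥ Q *ᵥ a + t * (a ⬝ᵥ y) ^ 2 := by
  rw [add_mulVec, dotProduct_add, smul_mulVec, dotProduct_smul, vecMulVec_mulVec,
    op_smul_eq_smul, dotProduct_smul, smul_eq_mul, smul_eq_mul, dotProduct_comm y a]
  ring

/-- Rescaling `Q + t y yᵀ` to feasibility turns constrained maximality into an inequality valid for
all `t ≥ 0`, ready to be differentiated at `0`. -/
theorem IsLewisForm.rpow_le (hd : 0 < d) (hp : 2 ≤ p) {Q : Matrix (Fin d) (Fin d) ℝ}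
    (hQ : IsLewisForm A p Q) (y : Fin d → ℝ) {t : ℝ} (ht : 0 ≤ t) :
    (1 + t * (y ⬝ᵥ Q⁻¹ *ᵥ y)) ^ (p / (2 * d)) ≤
      (∑ i, (A i ⬝ᵥ Q *ᵥ A i + t * (A i ⬝ᵥ y) ^ 2) ^ (p / 2)) / d := by
  have hp0 : 0 < p := by linarith
  have hd' : (0 : ℝ) < d := by exact_mod_cast hd
  have hPD := hQ.posDef hd hp
  set M := Q + t • vecMulVec y y with hM
  have hMpsd : M.PosSemidef := by
    refine hPD.posSemidef.add (PosSemidef.smul ?_ ht)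
    simpa using posSemidef_vecMulVec_self_star y
  have hdet : M.det = Q.det * (1 + t * (y ⬝ᵥ Q⁻¹ *ᵥ y)) :=
    det_add_smul_vecMulVec (isUnit_det_of_posDef hPD) t y
  have hu : 0 ≤ y ⬝ᵥ Q⁻¹ *ᵥ y := quad_nonneg hPD.inv.posSemidef y
  set u := y ⬝ᵥ Q⁻¹ *ᵥ y
  have hg : ∑ i, (A i ⬝ᵥ Q *ᵥ A i + t * (A i ⬝ᵥ y) ^ 2) ^ (p / 2) =
      ∑ i, (A i ⬝ᵥ M *ᵥ A i) ^ (p / 2) := by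
    simp only [hM, quad_add_smul_vecMulVec]
  rw [hg]
  set g := ∑ i, (A i ⬝ᵥ M *ᵥ A i) ^ (p / 2) with hgdef
  have hg0 : 0 ≤ g := Finset.sum_nonneg fun i _ => Real.rpow_nonneg (quad_nonneg hMpsd _) _
  have h1u : 0 < 1 + t * u := by positivity
  by_contra! hlt
  -- a scaling factor `s` that keeps `s • M` feasible while its determinant exceeds that of `Q`
  set b := (1 + t * u) ^ (p / (2 * d)) with hb
  have hb0 : 0 < b := Real.rpow_pos_of_pos h1u _
  -- Choosing `c` strictly above `g / d` makes it positive without knowing that `g` is.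
  obtain ⟨c, hc1, hc2⟩ := exists_between hlt
  have hc0 : 0 < c := lt_of_le_of_lt (by positivity) hc1
  have hfeas : IsFeasible A p (c⁻¹ ^ (2 / p) • M) := by
    refine isFeasible_smul hMpsd (by positivity) ?_
    rw [← Real.rpow_mul (by positivity), show 2 / p * (p / 2) = 1 by field_simp, Real.rpow_one,
      ← hgdef, inv_mul_eq_div, div_le_iff₀ hc0]
    rw [div_lt_iff₀ hd'] at hc1
    linarith
  have h2 := hQ.2 _ hfeas
  rw [det_smul, hdet, Fintype.card_fin, ← Real.rpow_natCast, ← Real.rpow_mul (by positivity)] at h2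
  have hQd := hPD.det_pos
  have h3 : c⁻¹ ^ (2 / p * d) * (1 + t * u) ≤ 1 := by
    have : Q.det * (c⁻¹ ^ (2 / p * d) * (1 + t * u)) ≤ Q.det * 1 := by linarith
    exact le_of_mul_le_mul_left this hQd
  have h4 : 1 + t * u = b ^ (2 / p * d) := by
    rw [hb, ← Real.rpow_mul h1u.le, show p / (2 * d) * (2 / p * d) = 1 by field_simp, Real.rpow_one]
  rw [h4, ← Real.mul_rpow (by positivity) hb0.le] at h3
  have h5 : 1 < c⁻¹ * b := by rwa [inv_mul_eq_div, one_lt_div hc0]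
  exact absurd h3 (not_le.mpr (Real.one_lt_rpow h5 (by positivity)))

/-- The trivial perturbation already shows that the constraint is active. -/
theorem IsLewisForm.sum_eq (hd : 0 < d) (hp : 2 ≤ p) {Q : Matrix (Fin d) (Fin d) ℝ}
    (hQ : IsLewisForm A p Q) : ∑ i, (A i ⬝ᵥ Q *ᵥ A i) ^ (p / 2) = d := by
  have hd' : (0 : ℝ) < d := by exact_mod_cast hd
  have h := hQ.rpow_le hd hp 0 le_rfl
  simp only [zero_mul, add_zero, Real.one_rpow] at h
  rw [le_div_iff₀ hd', one_mul] at h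
  exact le_antisymm hQ.1.2 h

/-- One-sided derivatives in the directions `y yᵀ` give `Y - Q⁻¹ ⪰ 0`. The active constraint makes
the trace of this difference against `Q` vanish, so the difference is zero. -/
theorem IsLewisForm.inv_eq_gram (hd : 0 < d) (hp : 2 ≤ p) {Q : Matrix (Fin d) (Fin d) ℝ}
    (hQ : IsLewisForm A p Q) : Q⁻¹ = gram A fun i => (A i ⬝ᵥ Q *ᵥ A i) ^ (p / 2 - 1) := by
  have hp0 : 0 < p := by linarith
  have hd' : (0 : ℝ) < d := by exact_mod_cast hd
  have hPD := hQ.posDef hd hp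
  have hτ := fun i => quad_nonneg hPD.posSemidef (A i)
  set τ := fun i => A i ⬝ᵥ Q *ᵥ A i with hτdef
  set Y := gram A fun i => τ i ^ (p / 2 - 1) with hY
  have hsymm : (Y - Q⁻¹)ᵀ = Y - Q⁻¹ := by
    rw [transpose_sub, hY, gram_transpose, isSymm_of_posSemidef hPD.inv.posSemidef]
  have hpsd : (Y - Q⁻¹).PosSemidef := by
    refine posSemidef_of_quad_nonneg hsymm fun y => ?_
    rw [sub_mulVec, dotProduct_sub, hY, quad_gram]
    set u := y ⬝ᵥ Q⁻¹ *ᵥ y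
    have hder : HasDerivAt (fun t : ℝ => (∑ i, (τ i + t * (A i ⬝ᵥ y) ^ 2) ^ (p / 2)) / d -
        (1 + t * u) ^ (p / (2 * d)))
        ((∑ i, (A i ⬝ᵥ y) ^ 2 * (p / 2) * τ i ^ (p / 2 - 1)) / d - u * (p / (2 * d))) 0 := by
      refine HasDerivAt.sub ?_ ?_
      · refine HasDerivAt.div_const ?_ _
        refine HasDerivAt.fun_sum fun i _ => ?_
        have h1 : HasDerivAt (fun t : ℝ => τ i + t * (A i ⬝ᵥ y) ^ 2) ((A i ⬝ᵥ y) ^ 2) 0 := by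
          simpa using ((hasDerivAt_id (0 : ℝ)).mul_const ((A i ⬝ᵥ y) ^ 2)).const_add (τ i)
        simpa using h1.rpow_const (p := p / 2) (Or.inr (by linarith))
      · have h1 : HasDerivAt (fun t : ℝ => 1 + t * u) u 0 := by
          simpa using ((hasDerivAt_id (0 : ℝ)).mul_const u).const_add 1
        simpa using h1.rpow_const (p := p / (2 * d)) (Or.inl (by simp))
    have h := deriv_nonneg_of_nonneg_right hder (by
      have := hQ.sum_eq hd hp
      simp [hτdef, this, hd'.ne']) (fun t ht => sub_nonneg.mpr (hQ.rpow_le hd hp y ht))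
    have e : (∑ i, (A i ⬝ᵥ y) ^ 2 * (p / 2) * τ i ^ (p / 2 - 1)) / d - u * (p / (2 * d)) =
        (∑ i, τ i ^ (p / 2 - 1) * (A i ⬝ᵥ y) ^ 2 - u) * (p / (2 * d)) := by
      have : ∑ i, (A i ⬝ᵥ y) ^ 2 * (p / 2) * τ i ^ (p / 2 - 1) =
          (∑ i, τ i ^ (p / 2 - 1) * (A i ⬝ᵥ y) ^ 2) * (p / 2) := by
        rw [Finset.sum_mul]
        exact Finset.sum_congr rfl fun i _ => by ring
      rw [this]
      field_simp
    rw [e] at h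
    exact nonneg_of_mul_nonneg_left h (by positivity)
  have htr : ((Y - Q⁻¹) * Q).trace = 0 := by
    rw [Matrix.sub_mul, trace_sub, nonsing_inv_mul _ (isUnit_det_of_posDef hPD), trace_one,
      Fintype.card_fin, hY, trace_gram_mul, sub_eq_zero, ← hQ.sum_eq hd hp]
    refine Finset.sum_congr rfl fun i _ => ?_
    change τ i ^ (p / 2 - 1) * τ i = τ i ^ (p / 2)
    -- If `τ i = 0` and `p = 2`, the power on the left is `0 ^ 0 = 1`; the factor `τ i` makes this
    -- harmless.
    rcases (hτ i).eq_or_lt with h | h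
    · have h' : τ i = 0 := h.symm
      rw [h', mul_zero, Real.zero_rpow (by positivity)]
    · rw [← Real.rpow_add_one h.ne', sub_add_cancel]
  exact (sub_eq_zero.mp (eq_zero_of_trace_mul_posDef hpsd hPD htr)).symm

/-- The determinant maximizer yields Lewis weights. -/
theorem IsLewisForm.isLewisWeights (hd : 0 < d) (hp : 2 ≤ p) {Q : Matrix (Fin d) (Fin d) ℝ}
    (hQ : IsLewisForm A p Q) :
    IsLewisWeights A p (fun i => (A i ⬝ᵥ Q *ᵥ A i) ^ (p / 2)) ∧
      Q = (weightedGram A p fun i => (A i ⬝ᵥ Q *ᵥ A i) ^ (p / 2))⁻¹ := by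
  have hp0 : 0 < p := by linarith
  have hPD := hQ.posDef hd hp
  have hτ := fun i => quad_nonneg hPD.posSemidef (A i)
  have e : weightedGram A p (fun i => (A i ⬝ᵥ Q *ᵥ A i) ^ (p / 2)) = Q⁻¹ := by
    rw [hQ.inv_eq_gram hd hp, weightedGram_eq_gram]
    congr 1
    funext i
    rw [← Real.rpow_mul (hτ i)]
    congr 1
    field_simp
  have hQQ : Q⁻¹⁻¹ = Q := nonsing_inv_nonsing_inv _ (isUnit_det_of_posDef hPD)
  refine ⟨⟨fun i => Real.rpow_nonneg (hτ i) _, ?_, fun i => ?_⟩, ?_⟩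
  · rw [e]; exact isUnit_det_of_posDef hPD.inv
  · rw [e, hQQ, ← Real.rpow_mul (hτ i), show p / 2 * (2 / p) = 1 by field_simp, Real.rpow_one]
  · rw [e, hQQ]

end Optimality

/-! ### Uniqueness -/

section Uniqueness

variable {n d : ℕ} {A : Matrix (Fin n) (Fin d) ℝ} {p : ℝ}

theorem IsLewisWeights.posDef {w : Fin n → ℝ} (hw : IsLewisWeights A p w) :
    (weightedGram A p w).PosDef :=
  posDef_of_det_pos (gram_posSemidef A fun i => Real.rpow_nonneg (hw.1 i) _) <|
    lt_of_le_of_ne (gram_posSemidef A fun i => Real.rpow_nonneg (hw.1 i) _).det_nonneg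
      hw.2.1.ne_zero.symm

theorem IsLewisWeights.eq_rpow (hp : 2 ≤ p) {w : Fin n → ℝ} (hw : IsLewisWeights A p w)
    (i : Fin n) : w i = (A i ⬝ᵥ (weightedGram A p w)⁻¹ *ᵥ A i) ^ (p / 2) := by
  have hp0 : 0 < p := by linarith
  rw [hw.2.2 i, ← Real.rpow_mul (hw.1 i), show 2 / p * (p / 2) = 1 by field_simp, Real.rpow_one]

/-- Pair the weighted Gram matrix with its inverse: the trace is that of the identity, and by the
Lewis equation each row contributes its own weight. -/
theorem IsLewisWeights.sum_eq (hp : 2 ≤ p) {w : Fin n → ℝ} (hw : IsLewisWeights A p w) :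
    ∑ i, w i = d := by
  have hp0 : 0 < p := by linarith
  have h := trace_gram_mul A (fun i => w i ^ (1 - 2 / p)) (weightedGram A p w)⁻¹
  rw [← weightedGram_eq_gram, mul_nonsing_inv _ hw.2.1, trace_one, Fintype.card_fin] at h
  rw [h]
  refine Finset.sum_congr rfl fun i _ => ?_
  rw [hw.2.2 i]
  rcases (hw.1 i).eq_or_lt with h0 | h0
  · rw [← h0, Real.zero_rpow (by positivity : 2 / p ≠ 0), mul_zero]
  · rw [← Real.rpow_add h0, sub_add_cancel, Real.rpow_one]

theorem IsLewisWeights.isFeasible_inv (hp : 2 ≤ p) {w : Fin n → ℝ} (hw : IsLewisWeights A p w) :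
    IsFeasible A p (weightedGram A p w)⁻¹ :=
  ⟨hw.posDef.inv.posSemidef, by
    rw [← hw.sum_eq hp]
    exact le_of_eq (Finset.sum_congr rfl fun i _ => (hw.eq_rpow hp i).symm)⟩

/-- The inverse Gram matrix of each solution is feasible, so weak duality applies in both directions
and the equality case of the trace estimate identifies the two matrices. The Lewis equation then
recovers the weights. -/
theorem IsLewisWeights.unique (hp : 2 ≤ p) {w w' : Fin n → ℝ} (hw : IsLewisWeights A p w)
    (hw' : IsLewisWeights A p w') : w = w' := by
  have h := eq_inv_of_trace_le hw.posDef hw'.posDef.inv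
    (trace_weightedGram_mul_le hp hw.1 (hw.sum_eq hp).le (hw'.isFeasible_inv hp)) (by
      rw [nonsing_inv_nonsing_inv _ hw'.2.1, Matrix.trace_mul_comm]
      exact trace_weightedGram_mul_le hp hw'.1 (hw'.sum_eq hp).le (hw.isFeasible_inv hp))
  funext i
  rw [hw.eq_rpow hp i, hw'.eq_rpow hp i, h]

/-- The Lewis weights and the Lewis quadratic form exist and are unique. -/
theorem exists_unique_lewis (hd : 0 < d) (hp : 2 ≤ p) (hA : A.rank = d) :
    ∃ (w : Fin n → ℝ) (Q : Matrix (Fin d) (Fin d) ℝ), (∀ w', IsLewisWeights A p w' ↔ w' = w) ∧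
      (∀ M, IsLewisForm A p M ↔ M = Q) ∧ Q = (weightedGram A p w)⁻¹ := by
  obtain ⟨Q, hQ⟩ := exists_isLewisForm hd hp hA
  obtain ⟨hw, hQw⟩ := hQ.isLewisWeights hd hp
  refine ⟨_, Q, fun w' => ⟨fun h => h.unique hp hw, fun h => h ▸ hw⟩,
    fun M => ⟨fun hM => ?_, fun h => h ▸ hQ⟩, hQw⟩
  obtain ⟨hv, hMv⟩ := hM.isLewisWeights hd hp
  rw [hMv, hv.unique hp hw, ← hQw]

end Uniqueness

end LewisWeights

namespace LewisWeights

open Matrix Filter Topology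

/-! ### The averaged fixed point iteration -/

section Iteration

variable {n d : ℕ}

/-- The leverage scores of the rows of `A` reweighted by `w ^ (1 / 2 - 1 / p)`. -/
noncomputable def leverage (A : Matrix (Fin n) (Fin d) ℝ) (p : ℝ) (w : Fin n → ℝ) : Fin n → ℝ :=
  fun i => w i ^ (1 - 2 / p) * (A i ⬝ᵥ (weightedGram A p w)⁻¹ *ᵥ A i)

/-- The fixed point iteration for Lewis weights, started at the uniform weights. -/
noncomputable def lewisIter (A : Matrix (Fin n) (Fin d) ℝ) (p : ℝ) : ℕ → Fin n → ℝ
  | 0 => fun _ => d / n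
  | k + 1 => leverage A p (lewisIter A p k)

/-- The average of the first `T` weighted Gram matrices of the iteration. -/
noncomputable def averageGram (A : Matrix (Fin n) (Fin d) ℝ) (p : ℝ) (T : ℕ) :
    Matrix (Fin d) (Fin d) ℝ :=
  (T : ℝ)⁻¹ • ∑ k ∈ Finset.range T, weightedGram A p (lewisIter A p k)

variable {A : Matrix (Fin n) (Fin d) ℝ} {p : ℝ}

theorem pos_of_rank (hd : 0 < d) (hA : A.rank = d) : 0 < n := by
  have := A.rank_le_height
  omega

theorem weightedGram_posDef (hA : A.rank = d) {w : Fin n → ℝ} (hw : ∀ i, 0 ≤ w i)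
    (hw' : ∀ i, A i ≠ 0 → 0 < w i) : (weightedGram A p w).PosDef :=
  gram_posDef hA (fun i => Real.rpow_nonneg (hw i) _) fun i hi => Real.rpow_pos_of_pos (hw' i hi) _

theorem lewisIter_nonneg_pos (hd : 0 < d) (hA : A.rank = d) (k : ℕ) :
    (∀ i, 0 ≤ lewisIter A p k i) ∧ ∀ i, A i ≠ 0 → 0 < lewisIter A p k i := by
  have hn := pos_of_rank hd hA
  induction k with
  | zero =>
    have : (0 : ℝ) < d / n := by positivity
    exact ⟨fun _ => this.le, fun _ _ => this⟩
  | succ k ih =>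
    have hPD := (weightedGram_posDef (p := p) hA ih.1 ih.2).inv
    exact ⟨fun i => mul_nonneg (Real.rpow_nonneg (ih.1 i) _) (quad_nonneg hPD.posSemidef _),
      fun i hi => mul_pos (Real.rpow_pos_of_pos (ih.2 i hi) _) (quad_pos hPD hi)⟩

theorem lewisIter_posDef (hd : 0 < d) (hA : A.rank = d) (k : ℕ) :
    (weightedGram A p (lewisIter A p k)).PosDef :=
  weightedGram_posDef hA (lewisIter_nonneg_pos hd hA k).1 (lewisIter_nonneg_pos hd hA k).2

theorem sum_lewisIter (hd : 0 < d) (hA : A.rank = d) (k : ℕ) :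
    ∑ i, lewisIter A p k i = d := by
  cases k with
  | zero =>
    have hn : (n : ℝ) ≠ 0 := by exact_mod_cast (pos_of_rank hd hA).ne'
    simp only [lewisIter, Finset.sum_const, Finset.card_univ, Fintype.card_fin, nsmul_eq_mul]
    field_simp
  | succ k =>
    have h := trace_gram_mul A (fun i => lewisIter A p k i ^ (1 - 2 / p))
      (weightedGram A p (lewisIter A p k))⁻¹
    rw [← weightedGram_eq_gram,
      mul_nonsing_inv _ (isUnit_det_of_posDef (lewisIter_posDef hd hA k)), trace_one,
      Fintype.card_fin] at h
    exact h.symm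

theorem lewisIter_le (hd : 0 < d) (hA : A.rank = d) (k : ℕ) (i : Fin n) :
    lewisIter A p k i ≤ d := by
  rw [← sum_lewisIter (p := p) hd hA k]
  exact Finset.single_le_sum (fun j _ => (lewisIter_nonneg_pos hd hA k).1 j) (Finset.mem_univ i)

/-- The average is again a Gram matrix, but its row weights average the powers of the iterates
rather than the iterates. -/
theorem averageGram_eq_gram (A : Matrix (Fin n) (Fin d) ℝ) (p : ℝ) (T : ℕ) :
    averageGram A p T =
      gram A fun i => (T : ℝ)⁻¹ * ∑ k ∈ Finset.range T, lewisIter A p k i ^ (1 - 2 / p) := by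
  ext j l
  rw [averageGram, Matrix.smul_apply, Matrix.sum_apply, gram_apply]
  simp only [weightedGram_eq_gram, gram_apply, smul_eq_mul]
  rw [Finset.sum_comm, Finset.mul_sum]
  refine Finset.sum_congr rfl fun i _ => ?_
  simp only [mul_assoc, Finset.sum_mul]

theorem averageGram_posDef (hd : 0 < d) (hA : A.rank = d) {T : ℕ} (hT : 0 < T) :
    (averageGram A p T).PosDef := by
  rw [averageGram_eq_gram]
  have h := fun k => lewisIter_nonneg_pos (p := p) hd hA k
  refine gram_posDef hA (fun i => ?_) fun i hi => ?_
  · exact mul_nonneg (by positivity)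
      (Finset.sum_nonneg fun k _ => Real.rpow_nonneg ((h k).1 i) _)
  · exact mul_pos (by positivity) (Finset.sum_pos
      (fun k _ => Real.rpow_pos_of_pos ((h k).2 i hi) _) ⟨0, Finset.mem_range.mpr hT⟩)

/-! ### Near-feasibility of the inverse averaged Gram matrix -/

theorem average_log_le {T : ℕ} (hT : 0 < T) {f : ℕ → ℝ} (hf : ∀ k, 0 < f k) :
    (T : ℝ)⁻¹ * ∑ k ∈ Finset.range T, Real.log (f k) ≤
      Real.log ((T : ℝ)⁻¹ * ∑ k ∈ Finset.range T, f k) := by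
  have h := strictConcaveOn_log_Ioi.concaveOn.le_map_sum (t := Finset.range T)
    (w := fun _ => (T : ℝ)⁻¹) (p := f) (fun _ _ => by positivity)
    (by simp [hT.ne']) (fun k _ => hf k)
  simpa [smul_eq_mul, ← Finset.mul_sum] using h

/-- Convexity of `X ↦ log (aᵀ X⁻¹ a)` on positive definite matrices. -/
theorem log_quad_inv_average_le {κ : Type*} [Fintype κ] [DecidableEq κ] {T : ℕ} (hT : 0 < T)
    {X : ℕ → Matrix κ κ ℝ} (hX : ∀ k, (X k).PosDef) {Y : Matrix κ κ ℝ} (hY : Y.PosDef)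
    (hYX : Y = (T : ℝ)⁻¹ • ∑ k ∈ Finset.range T, X k) {a : κ → ℝ} (ha : a ≠ 0) :
    Real.log (a ⬝ᵥ Y⁻¹ *ᵥ a) ≤
      (T : ℝ)⁻¹ * ∑ k ∈ Finset.range T, Real.log (a ⬝ᵥ (X k)⁻¹ *ᵥ a) := by
  set y := Y⁻¹ *ᵥ a with hy
  have hYy : Y *ᵥ y = a := by
    rw [hy, mulVec_mulVec, mul_nonsing_inv _ (isUnit_det_of_posDef hY), one_mulVec]
  have hy0 : y ≠ 0 := fun h => ha (by rw [← hYy, h, mulVec_zero])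
  have hτ : 0 < a ⬝ᵥ y := quad_pos hY.inv ha
  have hpos : ∀ k, 0 < y ⬝ᵥ X k *ᵥ y := fun k => quad_pos (hX k) hy0
  have hτk : ∀ k, 0 < a ⬝ᵥ (X k)⁻¹ *ᵥ a := fun k => quad_pos (hX k).inv ha
  -- Cauchy-Schwarz with the same vector `y = Y⁻¹ a` for every `k`. After averaging, Jensen bounds
  -- the last term by `log (aᵀ y)`, which cancels one of the two copies on the left.
  have hk : ∀ k, 2 * Real.log (a ⬝ᵥ y) ≤
      Real.log (a ⬝ᵥ (X k)⁻¹ *ᵥ a) + Real.log (y ⬝ᵥ X k *ᵥ y) := fun k => by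
    have h := Real.log_le_log (by positivity) (sq_dotProduct_le (hX k) a y)
    rwa [Real.log_pow, Real.log_mul (hτk k).ne' (hpos k).ne', Nat.cast_ofNat] at h
  have hsum := Finset.sum_le_sum fun k (_ : k ∈ Finset.range T) => hk k
  rw [Finset.sum_const, Finset.card_range, nsmul_eq_mul, Finset.sum_add_distrib] at hsum
  have hJ := average_log_le hT hpos
  have e : (T : ℝ)⁻¹ * ∑ k ∈ Finset.range T, y ⬝ᵥ X k *ᵥ y = a ⬝ᵥ y := by
    rw [← hYy, hYX, smul_mulVec, smul_dotProduct, sum_mulVec, sum_dotProduct, smul_eq_mul]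
    congr 1
    exact Finset.sum_congr rfl fun k _ => dotProduct_comm _ _
  rw [e] at hJ
  have hT' : (0 : ℝ) < T := by exact_mod_cast hT
  have hmul := mul_le_mul_of_nonneg_left hsum (inv_nonneg.mpr hT'.le)
  rw [inv_mul_cancel_left₀ hT'.ne', mul_add] at hmul
  linarith

/-- By the update rule the logarithm of the `k`-th quadratic form is `log w_{k+1} - log w_k + (2 /
p) log w_k`. The difference telescopes, and `w_T ≤ d` against the uniform start `d / n` leaves at
most `log n`. -/
theorem log_quad_averageGram_le (hd : 0 < d) (hA : A.rank = d) {T : ℕ} (hT : 0 < T) {i : Fin n}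
    (hi : A i ≠ 0) : Real.log (A i ⬝ᵥ (averageGram A p T)⁻¹ *ᵥ A i) ≤ Real.log n / T +
      2 / p * ((T : ℝ)⁻¹ * ∑ k ∈ Finset.range T, Real.log (lewisIter A p k i)) := by
  have hT' : (0 : ℝ) < T := by exact_mod_cast hT
  have hn : (0 : ℝ) < n := by exact_mod_cast pos_of_rank hd hA
  have hd' : (0 : ℝ) < d := by exact_mod_cast hd
  have hpos := fun k => (lewisIter_nonneg_pos (p := p) hd hA k).2 i hi
  refine (log_quad_inv_average_le hT (fun k => lewisIter_posDef (p := p) hd hA k)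
    (averageGram_posDef hd hA hT) rfl hi).trans ?_
  have hτ := fun k => quad_pos (lewisIter_posDef (p := p) hd hA k).inv hi
  have hstep : ∀ k, Real.log (A i ⬝ᵥ (weightedGram A p (lewisIter A p k))⁻¹ *ᵥ A i) =
      (Real.log (lewisIter A p (k + 1) i) - Real.log (lewisIter A p k i)) +
        2 / p * Real.log (lewisIter A p k i) := fun k => by
    have : Real.log (lewisIter A p (k + 1) i) = Real.log (lewisIter A p k i ^ (1 - 2 / p) *
      (A i ⬝ᵥ (weightedGram A p (lewisIter A p k))⁻¹ *ᵥ A i)) := rfl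
    rw [this, Real.log_mul (Real.rpow_pos_of_pos (hpos k) _).ne' (hτ k).ne',
      Real.log_rpow (hpos k)]
    ring
  rw [Finset.sum_congr rfl fun k _ => hstep k, Finset.sum_add_distrib,
    Finset.sum_range_sub fun k => Real.log (lewisIter A p k i), ← Finset.mul_sum]
  have h1 : Real.log (lewisIter A p T i) ≤ Real.log d :=
    Real.log_le_log (hpos T) (lewisIter_le hd hA T i)
  have h2 : Real.log (lewisIter A p 0 i) = Real.log d - Real.log n :=
    Real.log_div hd'.ne' hn.ne'
  have h3 : (T : ℝ)⁻¹ * (Real.log (lewisIter A p T i) - Real.log (lewisIter A p 0 i)) ≤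
      Real.log n / T := by
    rw [inv_mul_eq_div]
    exact div_le_div_of_nonneg_right (by linarith) hT'.le
  rw [mul_add]
  linarith

/-- Multiplying the logarithmic bound by `p / 2 - 1` gives the average logarithm the coefficient `1
- 2 / p`, so Jensen replaces it by the logarithm of the averaged row weight. -/
theorem rpow_quad_averageGram_le (hd : 0 < d) (hp : 2 ≤ p) (hA : A.rank = d) {T : ℕ} (hT : 0 < T)
    (i : Fin n) : (A i ⬝ᵥ (averageGram A p T)⁻¹ *ᵥ A i) ^ (p / 2) ≤
      Real.exp ((p / 2 - 1) * (Real.log n / T)) *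
        (((T : ℝ)⁻¹ * ∑ k ∈ Finset.range T, lewisIter A p k i ^ (1 - 2 / p)) *
          (A i ⬝ᵥ (averageGram A p T)⁻¹ *ᵥ A i)) := by
  have hp0 : 0 < p := by linarith
  have hq := one_sub_two_div_nonneg hp
  by_cases hi : A i = 0
  · rw [hi, zero_dotProduct, Real.zero_rpow (by positivity)]
    simp
  have hpos := fun k => (lewisIter_nonneg_pos (p := p) hd hA k).2 i hi
  have hτ := quad_pos (averageGram_posDef (p := p) hd hA hT).inv hi
  have hlog := log_quad_averageGram_le (p := p) hd hA hT hi
  have hJ := average_log_le hT (fun k => Real.rpow_pos_of_pos (hpos k) (1 - 2 / p))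
  have hv : 0 < (T : ℝ)⁻¹ * ∑ k ∈ Finset.range T, lewisIter A p k i ^ (1 - 2 / p) :=
    mul_pos (by positivity) (Finset.sum_pos
      (fun k _ => Real.rpow_pos_of_pos (hpos k) _) ⟨0, Finset.mem_range.mpr hT⟩)
  set τ := A i ⬝ᵥ (averageGram A p T)⁻¹ *ᵥ A i
  set v := (T : ℝ)⁻¹ * ∑ k ∈ Finset.range T, lewisIter A p k i ^ (1 - 2 / p)
  simp only [fun k => Real.log_rpow (hpos k), ← Finset.mul_sum] at hJ
  set ℓ := (T : ℝ)⁻¹ * ∑ k ∈ Finset.range T, Real.log (lewisIter A p k i) with hℓ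
  have hJ' : (1 - 2 / p) * ℓ ≤ Real.log v := by
    rw [hℓ]; linarith
  have h1 : τ ^ (p / 2) = τ ^ (p / 2 - 1) * τ := by
    rw [← Real.rpow_add_one hτ.ne', sub_add_cancel]
  rw [h1, ← mul_assoc]
  refine mul_le_mul_of_nonneg_right ?_ hτ.le
  rw [Real.rpow_def_of_pos hτ, ← Real.exp_log hv, ← Real.exp_add]
  refine Real.exp_le_exp.mpr ?_
  have h2 := mul_le_mul_of_nonneg_right hlog (show 0 ≤ p / 2 - 1 by linarith)
  have h3 : (Real.log n / T + 2 / p * ℓ) * (p / 2 - 1) =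
      (p / 2 - 1) * (Real.log n / T) + (1 - 2 / p) * ℓ := by
    field_simp
  rw [h3] at h2
  linarith

/-- Summing the row bounds produces the trace of the averaged matrix times its inverse, which is
exactly `d`. -/
theorem sum_quad_averageGram_le (hd : 0 < d) (hp : 2 ≤ p) (hA : A.rank = d) {T : ℕ}
    (hT : 0 < T) : ∑ i, (A i ⬝ᵥ (averageGram A p T)⁻¹ *ᵥ A i) ^ (p / 2) ≤
      Real.exp ((p / 2 - 1) * (Real.log n / T)) * d := by
  refine (Finset.sum_le_sum fun i _ => rpow_quad_averageGram_le hd hp hA hT i).trans ?_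
  rw [← Finset.mul_sum, ← trace_gram_mul, ← averageGram_eq_gram,
    mul_nonsing_inv _ (isUnit_det_of_posDef (averageGram_posDef hd hA hT)), trace_one,
    Fintype.card_fin]

/-! ### Accuracy of the averaged Gram matrix -/

/-- Weak duality is linear in the Gram matrix, so averaging over rounds costs nothing. -/
theorem trace_averageGram_mul_le (hd : 0 < d) (hp : 2 ≤ p) (hA : A.rank = d) {T : ℕ}
    (hT : 0 < T) {M : Matrix (Fin d) (Fin d) ℝ} (hM : IsFeasible A p M) :
    (averageGram A p T * M).trace ≤ d := by
  have hT' : (0 : ℝ) < T := by exact_mod_cast hT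
  rw [averageGram, smul_mul, trace_smul, Matrix.sum_mul, trace_sum, smul_eq_mul, inv_mul_le_iff₀ hT']
  calc ∑ k ∈ Finset.range T, (weightedGram A p (lewisIter A p k) * M).trace
      ≤ ∑ _k ∈ Finset.range T, (d : ℝ) := Finset.sum_le_sum fun k _ =>
        trace_weightedGram_mul_le hp (lewisIter_nonneg_pos hd hA k).1 (sum_lewisIter hd hA k).le hM
    _ = T * d := by simp

/-- The constraint is homogeneous of degree `p / 2`, so repairing an excess `exp ((p / 2 - 1) δ)`
costs only a factor `exp ((1 - 2 / p) δ)`. Weak duality then applies to the repaired matrix. -/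
theorem trace_inv_averageGram_mul_le (hd : 0 < d) (hp : 2 ≤ p) (hA : A.rank = d) {T : ℕ}
    (hT : 0 < T) {w : Fin n → ℝ} (hw : IsLewisWeights A p w) :
    ((averageGram A p T)⁻¹ * weightedGram A p w).trace ≤
      Real.exp ((1 - 2 / p) * (Real.log n / T)) * d := by
  have hp0 : 0 < p := by linarith
  set δ := Real.log n / T with hδ
  have hfeas : IsFeasible A p (Real.exp (-((1 - 2 / p) * δ)) • (averageGram A p T)⁻¹) := by
    refine isFeasible_smul (averageGram_posDef hd hA hT).inv.posSemidef (Real.exp_pos _).le ?_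
    refine (mul_le_mul_of_nonneg_left (sum_quad_averageGram_le hd hp hA hT)
      (Real.rpow_nonneg (Real.exp_pos _).le _)).trans (le_of_eq ?_)
    rw [← Real.exp_mul, ← mul_assoc, ← Real.exp_add, ← hδ,
      show -((1 - 2 / p) * δ) * (p / 2) + (p / 2 - 1) * δ = 0 by field_simp; ring, Real.exp_zero,
      one_mul]
  have h := trace_weightedGram_mul_le hp hw.1 (hw.sum_eq hp).le hfeas
  rw [Matrix.mul_smul, trace_smul, smul_eq_mul, Matrix.trace_mul_comm] at h
  have h2 := mul_le_mul_of_nonneg_left h (Real.exp_pos ((1 - 2 / p) * δ)).le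
  rwa [← mul_assoc, ← Real.exp_add, add_neg_cancel, Real.exp_zero, one_mul] at h2

theorem loewnerApprox_averageGram (hd : 0 < d) (hp : 2 ≤ p) (hA : A.rank = d) {T : ℕ}
    (hT : 0 < T) {w : Fin n → ℝ} (hw : IsLewisWeights A p w) {β : ℝ} (hβ : 1 ≤ β)
    (h₁ : Real.log n ≤ T) (h₂ : 2 * d * Real.log n ≤ T * (β + β⁻¹ - 2)) :
    LoewnerApprox β (averageGram A p T)⁻¹ (weightedGram A p w)⁻¹ := by
  have hT' : (0 : ℝ) < T := by exact_mod_cast hT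
  have hp0 : 0 < p := by linarith
  have hlog : 0 ≤ Real.log n := Real.log_natCast_nonneg n
  have hδ0 : 0 ≤ Real.log n / T := by positivity
  have hδ1 : Real.log n / T ≤ 1 := by rwa [div_le_one hT']
  refine loewnerApprox_inv_of_trace_le (θ := 2 * d * (Real.log n / T))
    (averageGram_posDef hd hA hT) hw.posDef.inv
    (trace_averageGram_mul_le hd hp hA hT (hw.isFeasible_inv hp)) ?_ hβ ?_
  · rw [nonsing_inv_nonsing_inv _ hw.2.1]
    refine (trace_inv_averageGram_mul_le hd hp hA hT hw).trans ?_
    -- Since `δ ≤ 1`, `exp δ ≤ 1 + 2 δ`; this is the source of `θ = 2 d δ`.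
    have h3 : Real.exp ((1 - 2 / p) * (Real.log n / T)) ≤ 1 + 2 * (Real.log n / T) := by
      have h4 : (1 - 2 / p) * (Real.log n / T) ≤ Real.log n / T :=
        mul_le_of_le_one_left hδ0 (by linarith [div_nonneg zero_le_two hp0.le])
      refine (Real.exp_le_exp.mpr h4).trans ?_
      have := Real.abs_exp_sub_one_le (x := Real.log n / T) (by rwa [abs_of_nonneg hδ0])
      rw [abs_of_nonneg hδ0] at this
      linarith [le_abs_self (Real.exp (Real.log n / T) - 1)]
    calc _ ≤ (1 + 2 * (Real.log n / T)) * d := mul_le_mul_of_nonneg_right h3 (by positivity)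
      _ = _ := by ring
  · rw [← mul_div_assoc, div_le_iff₀ hT']
    linarith

/-- Weights are `p / 2`-th powers of quadratic forms, so accuracy `α` for them requires accuracy `α
^ (2 / p)` for the form. -/
theorem approx_rpow_of_loewnerApprox (hp : 2 ≤ p) {α : ℝ} (hα : 1 ≤ α)
    {M Q : Matrix (Fin d) (Fin d) ℝ} (hM : M.PosSemidef)
    (h : LoewnerApprox (α ^ (2 / p)) M Q) (a : Fin d → ℝ) :
    Approx α ((a ⬝ᵥ M *ᵥ a) ^ (p / 2)) ((a ⬝ᵥ Q *ᵥ a) ^ (p / 2)) := by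
  have hp0 : 0 < p := by linarith
  have hα0 : 0 < α := by linarith
  have h1 := quad_nonneg h.1 a
  have h2 := quad_nonneg h.2 a
  rw [sub_mulVec, dotProduct_sub, smul_mulVec, dotProduct_smul, sub_nonneg, smul_eq_mul] at h1 h2
  have hMa := quad_nonneg hM a
  have hβ : 0 < α ^ (2 / p) := Real.rpow_pos_of_pos hα0 _
  have hQa : 0 ≤ a ⬝ᵥ Q *ᵥ a := le_trans (by positivity) h1
  have e : (α ^ (2 / p)) ^ (p / 2) = α := by
    rw [← Real.rpow_mul hα0.le, show 2 / p * (p / 2) = 1 by field_simp, Real.rpow_one]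
  constructor
  · have := Real.rpow_le_rpow (by positivity) h1 (show 0 ≤ p / 2 by linarith)
    rwa [Real.mul_rpow (by positivity) hMa, one_div, Real.inv_rpow hβ.le, e, ← one_div] at this
  · have := Real.rpow_le_rpow hQa h2 (show 0 ≤ p / 2 by linarith)
    rwa [Real.mul_rpow hβ.le hMa, e] at this

theorem LoewnerApprox.mono {α β : ℝ} (hα : 0 < α) (hαβ : α ≤ β) {M Q : Matrix (Fin d) (Fin d) ℝ}
    (hM : M.PosSemidef) (h : LoewnerApprox α M Q) : LoewnerApprox β M Q := by
  have h1 : 0 ≤ 1 / α - 1 / β := sub_nonneg.mpr (one_div_le_one_div_of_le hα hαβ)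
  constructor
  · have := h.1.add (hM.smul h1)
    rwa [sub_smul, sub_add_sub_cancel] at this
  · have := h.2.add (hM.smul (sub_nonneg.mpr hαβ))
    rwa [sub_smul, add_comm, sub_add_sub_cancel] at this

/-- The number of iterations, per dimension and logarithm of the number of rows, that suffices
for accuracy `ε`. -/
noncomputable def iterationFactor (p ε : ℝ) : ℝ :=
  1 + 2 / ((1 + ε) ^ (2 / p) + 1 / (1 + ε) ^ (2 / p) - 2)

theorem rpow_add_inv_sub_two_pos (hp : 2 ≤ p) {ε : ℝ} (hε : 0 < ε) :
    0 < (1 + ε) ^ (2 / p) + 1 / (1 + ε) ^ (2 / p) - 2 := by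
  have hβ : 1 < (1 + ε) ^ (2 / p) := Real.one_lt_rpow (by linarith) (by positivity)
  have : (1 + ε) ^ (2 / p) + 1 / (1 + ε) ^ (2 / p) - 2 =
      ((1 + ε) ^ (2 / p) - 1) ^ 2 / (1 + ε) ^ (2 / p) := by
    field_simp
    ring
  rw [this]
  have : 0 < (1 + ε) ^ (2 / p) - 1 := by linarith
  positivity

theorem one_le_iterationFactor (hp : 2 ≤ p) {ε : ℝ} (hε : 0 < ε) : 1 ≤ iterationFactor p ε :=
  le_add_of_nonneg_right (div_nonneg zero_le_two (rpow_add_inv_sub_two_pos hp hε).le)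

/-- Correctness of the averaged iteration. -/
theorem averageGram_approx (hd : 0 < d) (hp : 2 ≤ p) (hA : A.rank = d) {ε : ℝ} (hε : 0 < ε)
    {T : ℕ} (hT : 0 < T) (h : iterationFactor p ε * (d * Real.log n) ≤ T) {w : Fin n → ℝ}
    (hw : IsLewisWeights A p w) :
    LoewnerApprox (1 + ε) (averageGram A p T)⁻¹ (weightedGram A p w)⁻¹ ∧
      ∀ i, Approx (1 + ε) ((A i ⬝ᵥ (averageGram A p T)⁻¹ *ᵥ A i) ^ (p / 2)) (w i) := by
  have hη := rpow_add_inv_sub_two_pos hp hε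
  have hp0 : 0 < p := by linarith
  set β := (1 + ε) ^ (2 / p) with hβdef
  have hβ1 : 1 ≤ β := Real.one_le_rpow (by linarith) (by positivity)
  have hβ2 : β ≤ 1 + ε := by
    conv_rhs => rw [← Real.rpow_one (1 + ε)]
    exact Real.rpow_le_rpow_of_exponent_le (by linarith) (by rw [div_le_one hp0]; exact hp)
  have hd1 : (1 : ℝ) ≤ d := by exact_mod_cast hd
  have hlog : 0 ≤ Real.log n := Real.log_natCast_nonneg n
  have hdl : Real.log n ≤ d * Real.log n := le_mul_of_one_le_left hlog hd1
  rw [iterationFactor, ← hβdef, add_mul, one_mul] at h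
  have hpos : 0 ≤ 2 / (β + 1 / β - 2) * (d * Real.log n) := by positivity
  have h1 : Real.log n ≤ T := by linarith
  have h2 : 2 * d * Real.log n ≤ T * (β + β⁻¹ - 2) := by
    have h3 : 2 / (β + 1 / β - 2) * (d * Real.log n) ≤ T := by linarith
    rw [div_mul_eq_mul_div, div_le_iff₀ hη, one_div] at h3
    linarith
  have hL := loewnerApprox_averageGram hd hp hA hT hw hβ1 h1 h2
  have hM := (averageGram_posDef (p := p) hd hA hT).inv.posSemidef
  refine ⟨hL.mono (by linarith) hβ2 hM, fun i => ?_⟩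
  rw [hw.eq_rpow hp i]
  exact approx_rpow_of_loewnerApprox hp (by linarith) hM hL (A i)

end Iteration

end LewisWeights

namespace RealRAM

/-! ### A program logic with step counts -/

/-- The contents of all arrays. -/
abbrev Store := ℕ → ℕ → ℕ → ℝ

/-- Overwrite one array entry. -/
noncomputable def put (ρ : Store) (a i j : ℕ) (v : ℝ) : Store :=
  Function.update ρ a (Function.update (ρ a) i (Function.update (ρ a i) j v))

theorem put_of_ne (ρ : Store) {a b : ℕ} (h : b ≠ a) (i j : ℕ) (v : ℝ) : put ρ a i j v b = ρ b :=
  Function.update_of_ne h _ _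

theorem put_apply (ρ : Store) (a i j : ℕ) (v : ℝ) (i' j' : ℕ) :
    put ρ a i j v a i' j' = if i' = i ∧ j' = j then v else ρ a i' j' := by
  by_cases hi : i' = i <;> by_cases hj : j' = j <;> simp [put, hi, hj]

theorem put_self (ρ : Store) (a i j : ℕ) (v : ℝ) : put ρ a i j v a i j = v := by
  simp [put]

theorem put_put (ρ : Store) (a i j : ℕ) (v v' : ℝ) :
    put (put ρ a i j v) a i j v' = put ρ a i j v' := by
  simp [put]

/-- `Achieves P c ν ρ Q`: started with registers `ν` and arrays `ρ`, the program `P` halts after at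
most `c` steps, leaves the registers unchanged, and the final arrays satisfy `Q`. -/
def Achieves (P : Program) (c : ℕ) (ν : ℕ → ℕ) (ρ : Store) (Q : Store → Prop) : Prop :=
  ∃ t ρ', t ≤ c ∧ Runs P ⟨ν, ρ⟩ t ⟨ν, ρ'⟩ ∧ Q ρ'

theorem Achieves.mono {P : Program} {c c' : ℕ} {ν : ℕ → ℕ} {ρ : Store} {Q Q' : Store → Prop}
    (h : Achieves P c ν ρ Q) (hc : c ≤ c') (hQ : ∀ ρ', Q ρ' → Q' ρ') : Achieves P c' ν ρ Q' := by
  obtain ⟨t, ρ', ht, hr, hq⟩ := h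
  exact ⟨t, ρ', ht.trans hc, hr, hQ _ hq⟩

theorem Achieves.seq {P₁ P₂ : Program} {c₁ c₂ : ℕ} {ν : ℕ → ℕ} {ρ : Store} {Q₁ Q₂ : Store → Prop}
    (h₁ : Achieves P₁ c₁ ν ρ Q₁) (h₂ : ∀ ρ', Q₁ ρ' → Achieves P₂ c₂ ν ρ' Q₂) :
    Achieves (.seq P₁ P₂) (c₁ + c₂) ν ρ Q₂ := by
  obtain ⟨t, ρ', ht, hr, hq⟩ := h₁
  obtain ⟨t', ρ'', ht', hr', hq'⟩ := h₂ ρ' hq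
  exact ⟨t + t', ρ'', by omega, .seq hr hr', hq'⟩

theorem Achieves.setReal {a : ℕ} {i j : NExp} {e : RExp} {ν : ℕ → ℕ} {ρ : Store} :
    Achieves (.setReal a i j e) (i.cost + j.cost + e.cost + 1) ν ρ
      (fun ρ' => ρ' = put ρ a (i.eval ⟨ν, ρ⟩) (j.eval ⟨ν, ρ⟩) (e.eval ⟨ν, ρ⟩)) :=
  ⟨_, _, le_rfl, .setReal _ _ _ _ _, rfl⟩

/-- Total correctness of loops: `I k` holds before the `k`-th execution of the body, of which there
are `N`. -/
theorem exists_runs_loop {b : BExp} {P : Program} {c N : ℕ} (I : ℕ → State → Prop)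
    (hstep : ∀ k < N, ∀ σ, I k σ → b.eval σ ∧ ∃ t τ, t ≤ c ∧ Runs P σ t τ ∧ I (k + 1) τ)
    (hdone : ∀ σ, I N σ → ¬ b.eval σ) {σ : State} (h0 : I 0 σ) :
    ∃ t τ, t ≤ N * (b.cost + 1 + c) + (b.cost + 1) ∧ Runs (.loop b P) σ t τ ∧ I N τ := by
  suffices H : ∀ m k, k + m = N → ∀ σ, I k σ →
      ∃ t τ, t ≤ m * (b.cost + 1 + c) + (b.cost + 1) ∧ Runs (.loop b P) σ t τ ∧ I N τ from
    H N 0 (by omega) σ h0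
  intro m
  induction m with
  | zero =>
    intro k hk σ hσ
    obtain rfl : k = N := by omega
    exact ⟨_, σ, by omega, .loopFalse (hdone σ hσ), hσ⟩
  | succ m ih =>
    intro k hk σ hσ
    obtain ⟨hb, t, τ, ht, hr, hI⟩ := hstep k (by omega) σ hσ
    obtain ⟨t', τ', ht', hr', hI'⟩ := ih (k + 1) (by omega) τ hI
    refine ⟨_, τ', ?_, .loopTrue hb hr hr', hI'⟩
    rw [Nat.succ_mul]
    omega

/-- `for x < y do body`, where `x` and `y` are registers. The counter `x` has to be zero initially,
and is reset to zero. -/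
def forLoop (x y : ℕ) (body : Program) : Program :=
  .seq (.loop (.neg (.natLe (.reg y) (.reg x)))
    (.seq body (.setNat x (.add (.reg x) (.const 1))))) (.setNat x (.const 0))

/-- Resetting the counter restores the registers exactly, which lets loops nest and compose under
`Achieves`. -/
theorem Achieves.forLoop {x y : ℕ} {body : Program} {c : ℕ} {ν : ℕ → ℕ} {ρ : Store}
    (hxy : x ≠ y) (hx : ν x = 0) (hy : 0 < ν y) (I : ℕ → Store → Prop) (h0 : I 0 ρ)
    (hstep : ∀ k < ν y, ∀ ρ', I k ρ' →
      Achieves body c (Function.update ν x k) ρ' (I (k + 1))) :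
    Achieves (forLoop x y body) (ν y * (c + 16)) ν ρ (I (ν y)) := by
  have hν : Function.update ν x 0 = ν := by rw [← hx, Function.update_eq_self]
  obtain ⟨t, τ, ht, hr, ⟨hn, hI⟩⟩ := exists_runs_loop (b := .neg (.natLe (.reg y) (.reg x)))
    (P := .seq body (.setNat x (.add (.reg x) (.const 1)))) (c := c + 4) (N := ν y)
    (fun k σ => σ.nat = Function.update ν x k ∧ I k σ.real)
    (by
      rintro k hk ⟨νσ, ρσ⟩ ⟨hσ, hI⟩
      simp only at hσ hI
      subst hσ
      refine ⟨by simpa [BExp.eval, NExp.eval, Function.update_of_ne hxy.symm] using hk, ?_⟩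
      obtain ⟨t, ρ', ht, hr, hI'⟩ := hstep k hk ρσ hI
      refine ⟨_, _, ?_, .seq hr (.setNat _ _ _), ?_, hI'⟩
      · simp only [NExp.cost]; omega
      · simp [State.setNat, NExp.eval])
    (by
      rintro ⟨νσ, ρσ⟩ ⟨hσ, -⟩
      simp only at hσ
      subst hσ
      simp [BExp.eval, NExp.eval, Function.update_of_ne hxy.symm])
    (σ := ⟨ν, ρ⟩) ⟨hν.symm, h0⟩
  obtain ⟨ντ, ρτ⟩ := τ
  simp only at hn hI
  subst hn
  refine ⟨t + 2, ρτ, ?_, ?_, hI⟩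
  · simp only [BExp.cost, NExp.cost] at ht
    -- The final failed test and the reset take `7` steps; there is at least one iteration to charge
    -- them to.
    have : ν y * (c + 16) = ν y * (c + 9) + 7 * ν y := by ring
    have e : ν y * (1 + 1 + 1 + 1 + 1 + (c + 4)) = ν y * (c + 9) := by ring
    omega
  · have h := Runs.setNat ⟨Function.update ν x (ν y), ρτ⟩ x (.const 0)
    simp only [State.setNat, NExp.eval, Function.update_idem, hν, NExp.cost] at h
    exact .seq hr h

/-- `a[i, j] := ∑ x < y, e`. -/
def sumInto (a : ℕ) (i j : NExp) (x y : ℕ) (e : RExp) : Program :=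
  .seq (.setReal a i j (.const 0)) (forLoop x y (.setReal a i j (.add (.get a i j) e)))

/-- The summand must have the same value whatever partial sum `s` sits in the target entry. -/
theorem Achieves.sumInto {a x y I J : ℕ} {i j : NExp} {e : RExp} {ν : ℕ → ℕ} {ρ : Store}
    {N : ℕ} (hxy : x ≠ y) (hx : ν x = 0) (hy : ν y = N) (hN : 0 < N)
    (hi : ∀ k ρ', i.eval ⟨Function.update ν x k, ρ'⟩ = I)
    (hj : ∀ k ρ', j.eval ⟨Function.update ν x k, ρ'⟩ = J) (f : ℕ → ℝ)
    (he : ∀ k < N, ∀ s, e.eval ⟨Function.update ν x k, put ρ a I J s⟩ = f k) :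
    Achieves (sumInto a i j x y e) (N * (3 * i.cost + 3 * j.cost + e.cost + 21)) ν ρ
      (fun ρ' => ρ' = put ρ a I J (∑ k ∈ Finset.range N, f k)) := by
  subst hy
  have hν : Function.update ν x 0 = ν := by rw [← hx, Function.update_eq_self]
  have hi0 := hi 0
  have hj0 := hj 0
  rw [hν] at hi0 hj0
  have h := Achieves.seq (ν := ν) (ρ := ρ) (Achieves.setReal (a := a) (i := i) (j := j)
    (e := .const 0)) (c₂ := ν y * (i.cost + j.cost + (RExp.add (.get a i j) e).cost + 1 + 16))
    (Q₂ := fun ρ' => ρ' = put ρ a I J (∑ k ∈ Finset.range (ν y), f k)) (by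
      intro ρ' hρ'
      rw [hi0, hj0] at hρ'
      refine Achieves.forLoop (body := .setReal a i j (.add (.get a i j) e)) hxy hx hN
        (fun m ρ' => ρ' = put ρ a I J (∑ k ∈ Finset.range m, f k)) ?_ ?_
      · simpa [RExp.eval] using hρ'
      · rintro k hk ρ' rfl
        refine Achieves.setReal.mono le_rfl ?_
        rintro ρ'' rfl
        simp only [RExp.eval, hi, hj, he k hk, put_self, put_put, Finset.sum_range_succ])
  refine h.mono ?_ fun _ h => h
  simp only [RExp.cost]
  have : i.cost + j.cost + 1 + 1 ≤ ν y * (i.cost + j.cost + 1 + 1) := Nat.le_mul_of_pos_left _ hN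
  calc _ ≤ ν y * (i.cost + j.cost + 1 + 1) + _ := Nat.add_le_add_right this _
    _ = _ := by ring

/-- Filling column `0` of the array `a`. -/
theorem Achieves.fillColumn {a x y N c : ℕ} {body : Program} {ν : ℕ → ℕ} {ρ : Store}
    (hxy : x ≠ y) (hx : ν x = 0) (hy : ν y = N) (hN : 0 < N) (F : ℕ → ℝ)
    (hbody : ∀ i < N, ∀ ρ', (∀ b, b ≠ a → ρ' b = ρ b) → ρ' a i 0 = ρ a i 0 →
      Achieves body c (Function.update ν x i) ρ' (fun ρ'' => ρ'' = put ρ' a i 0 (F i))) :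
    Achieves (RealRAM.forLoop x y body) (N * (c + 16)) ν ρ
      (fun ρ' => (∀ b, b ≠ a → ρ' b = ρ b) ∧ ∀ i < N, ρ' a i 0 = F i) := by
  subst hy
  refine (Achieves.forLoop hxy hx hN (fun k ρ' => (∀ b, b ≠ a → ρ' b = ρ b) ∧
    ∀ i, ρ' a i 0 = if i < k then F i else ρ a i 0) (by simp) ?_).mono le_rfl ?_
  · rintro k hk ρ' ⟨h1, h2⟩
    refine (hbody k hk ρ' h1 (by simp [h2])).mono le_rfl ?_
    rintro ρ'' rfl
    refine ⟨fun b hb => by rw [put_of_ne _ hb, h1 b hb], fun i => ?_⟩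
    rw [put_apply, h2]
    rcases lt_trichotomy i k with h | h | h
    · simp [h.ne, h, h.trans (Nat.lt_succ_self k)]
    · simp [h]
    · simp [h.ne', h.not_gt, show ¬ i < k + 1 by omega]
  · rintro ρ' ⟨h1, h2⟩
    exact ⟨h1, fun i hi => by rw [h2, if_pos hi]⟩

/-- Filling a rectangle of the array `a`. -/
theorem Achieves.fillMatrix {a x y rx ry N M c : ℕ} {body : Program} {ν : ℕ → ℕ} {ρ : Store}
    (hxrx : x ≠ rx) (hyry : y ≠ ry) (hxy : x ≠ y) (hxry : x ≠ ry) (hx : ν x = 0) (hy : ν y = 0)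
    (hrx : ν rx = N) (hry : ν ry = M) (hN : 0 < N) (hM : 0 < M) (F : ℕ → ℕ → ℝ)
    (hbody : ∀ i < N, ∀ j < M, ∀ ρ', (∀ b, b ≠ a → ρ' b = ρ b) → ρ' a i j = ρ a i j →
      Achieves body c (Function.update (Function.update ν x i) y j) ρ'
        (fun ρ'' => ρ'' = put ρ' a i j (F i j))) :
    Achieves (RealRAM.forLoop x rx (RealRAM.forLoop y ry body)) (N * (M * (c + 16) + 16)) ν ρ
      (fun ρ' => (∀ b, b ≠ a → ρ' b = ρ b) ∧ ∀ i < N, ∀ j < M, ρ' a i j = F i j) := by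
  subst hrx hry
  refine (Achieves.forLoop (c := ν ry * (c + 16)) hxrx hx hN
    (fun k ρ' => (∀ b, b ≠ a → ρ' b = ρ b) ∧
      ∀ i j, j < ν ry → ρ' a i j = if i < k then F i j else ρ a i j) (by simp) ?_).mono le_rfl ?_
  · rintro k hk ρ' ⟨h1, h2⟩
    have hry' : Function.update ν x k ry = ν ry := Function.update_of_ne hxry.symm _ _
    have H := Achieves.forLoop (x := y) (y := ry) (body := body) (c := c)
      (ν := Function.update ν x k) (ρ := ρ') hyry
      (by rwa [Function.update_of_ne hxy.symm]) (by rwa [hry'])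
      -- Rows before `k` are complete, and row `k` is filled up to column `l`.
      (fun l ρ'' => (∀ b, b ≠ a → ρ'' b = ρ b) ∧ ∀ i j, j < ν ry → ρ'' a i j =
        if i < k ∨ (i = k ∧ j < l) then F i j else ρ a i j)
      ⟨h1, fun i j hj => by simp [h2 i j hj]⟩ (by
        rintro l hl ρ'' ⟨h3, h4⟩
        rw [hry'] at hl
        refine (hbody k hk l hl ρ'' h3 (by simp [h4 k l hl])).mono le_rfl ?_
        rintro _ rfl
        refine ⟨fun b hb => by rw [put_of_ne _ hb, h3 b hb], fun i j hj => ?_⟩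
        rw [put_apply, h4 i j hj]
        by_cases hi : i = k
        · subst hi
          by_cases hjl : j = l
          · subst hjl; simp
          · have : j < l + 1 ↔ j < l := by omega
            simp [hjl, this]
        · simp [hi])
    rw [hry'] at H
    refine H.mono le_rfl ?_
    rintro ρ'' ⟨h3, h4⟩
    refine ⟨h3, fun i j hj => ?_⟩
    rw [h4 i j hj]
    have : (i < k ∨ i = k ∧ j < ν ry) ↔ i < k + 1 := by omega
    simp only [this]
  · rintro ρ' ⟨h1, h2⟩
    exact ⟨h1, fun i hi j hj => by rw [h2 i j hj, if_pos hi]⟩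

end RealRAM

namespace RealRAM

open Matrix

/-! ### Matrix inversion by orthogonal completion -/

section Inverse

variable {d : ℕ}

/-- One step of the inversion of `X`: a rank one correction of `N` after which `N * X` also fixes
the `k`-th basis vector. -/
noncomputable def inverseStep (X : Matrix (Fin d) (Fin d) ℝ) (k : Fin d)
    (N : Matrix (Fin d) (Fin d) ℝ) : Matrix (Fin d) (Fin d) ℝ :=
  let u := (N * X).col k - Pi.single k 1
  N - (u ⬝ᵥ X.col k)⁻¹ • vecMulVec u u

/-- `N` inverts `X` on the span of the first `k` basis vectors. -/
structure IsPartialInverse (X : Matrix (Fin d) (Fin d) ℝ) (k : ℕ)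
    (N : Matrix (Fin d) (Fin d) ℝ) : Prop where
  symm : Nᵀ = N
  row_eq_zero : ∀ i j : Fin d, k ≤ i → N i j = 0
  col_mul : ∀ j : Fin d, (j : ℕ) < k → (N * X).col j = Pi.single j 1

theorem isPartialInverse_zero (X : Matrix (Fin d) (Fin d) ℝ) : IsPartialInverse X 0 0 :=
  ⟨by simp, by simp, by simp⟩

theorem IsPartialInverse.eq_inv {X N : Matrix (Fin d) (Fin d) ℝ} (h : IsPartialInverse X d N) :
    N = X⁻¹ := by
  refine (inv_eq_left_inv ?_).symm
  ext i j
  have := congrFun (h.col_mul j j.2) i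
  rw [col_apply] at this
  rw [this, Pi.single_apply, one_apply]

/-- With `u = N X e_k - e_k`, symmetry of `N` and `X` makes `u` orthogonal to `X e_j` for `j < k`,
so the correction leaves the earlier columns alone and subtracts exactly `u` from column `k`. -/
theorem IsPartialInverse.step {X N : Matrix (Fin d) (Fin d) ℝ} (hX : X.PosDef) {k : Fin d}
    (h : IsPartialInverse X k N) : IsPartialInverse X (k + 1) (inverseStep X k N) := by
  have hs : Xᵀ = X := LewisWeights.isSymm_of_posSemidef hX.posSemidef
  have hcol : ∀ j, X.col j = X *ᵥ Pi.single j 1 := fun j => by simp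
  have hNX : ∀ j, (N * X).col j = N *ᵥ X.col j := fun j => by
    rw [hcol, mulVec_mulVec, mulVec_single_one]
  set u := (N * X).col k - Pi.single k 1 with hu
  have hu_single : ∀ i : Fin d, (k : ℕ) ≤ i → u i = - (Pi.single k 1 : Fin d → ℝ) i := by
    intro i hi
    have : (N * X).col k i = 0 := by
      rw [col_apply, mul_apply]
      exact Finset.sum_eq_zero fun j _ => by rw [h.row_eq_zero i j hi, zero_mul]
    rw [hu, Pi.sub_apply, this, zero_sub]
  have horth : ∀ j : Fin d, (j : ℕ) < k → u ⬝ᵥ X.col j = 0 := by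
    intro j hj
    have h1 : (N * X).col k ⬝ᵥ X.col j = X.col k ⬝ᵥ Pi.single j 1 := by
      rw [hNX, ← h.col_mul j hj, hNX, dotProduct_mulVec, ← mulVec_transpose, h.symm]
    rw [hu, sub_dotProduct, h1, dotProduct_single_one, single_one_dotProduct, col_apply, col_apply]
    have := congrFun (congrFun hs j) k
    rw [transpose_apply] at this
    rw [this, sub_self]
  -- Since `u` has entry `-1` at `k`, vanishes beyond `k` and is orthogonal to the earlier columns
  -- of `X`, the pivot is `-uᵀ X u`. Positive definiteness thus removes any need for pivoting.
  have hne : u ⬝ᵥ X.col k ≠ 0 := by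
    have hu0 : u ≠ 0 := fun h0 => by
      have := hu_single k le_rfl
      simp [h0] at this
    have hpos := LewisWeights.quad_pos hX hu0
    have e : u ⬝ᵥ X *ᵥ u = - (u ⬝ᵥ X.col k) := by
      have h2 : X *ᵥ u = ∑ j, u j • X.col j := by
        ext i
        simp [mulVec, dotProduct, mul_comm]
      rw [h2, dotProduct_sum, Finset.sum_eq_single k]
      · rw [hu_single k le_rfl, dotProduct_smul, Pi.single_eq_same]; simp
      · intro j _ hjk
        rw [dotProduct_smul]
        rcases lt_or_gt_of_ne (fun h => hjk (Fin.ext h) : (j : ℕ) ≠ k) with hlt | hgt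
        · rw [horth j hlt, smul_zero]
        · rw [hu_single j hgt.le, Pi.single_eq_of_ne hjk, neg_zero, zero_smul]
      · simp
    intro h0
    rw [e, h0, neg_zero] at hpos
    exact hpos.false
  have hstep : inverseStep X k N = N - (u ⬝ᵥ X.col k)⁻¹ • vecMulVec u u := rfl
  have hcol_step : ∀ j, (inverseStep X k N * X).col j =
      (N * X).col j - ((u ⬝ᵥ X.col k)⁻¹ * (u ⬝ᵥ X.col j)) • u := by
    intro j
    rw [← mulVec_single_one (_ * X), ← mulVec_mulVec, ← hcol, hstep, sub_mulVec, hNX, smul_mulVec,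
      vecMulVec_mulVec, op_smul_eq_smul, smul_smul]
  refine ⟨?_, fun i j hi => ?_, fun j hj => ?_⟩
  · rw [hstep, transpose_sub, transpose_smul, transpose_vecMulVec, h.symm]
  · rw [hstep, Matrix.sub_apply, Matrix.smul_apply, vecMulVec_apply, h.row_eq_zero i j (by omega),
      hu_single i (by omega), Pi.single_eq_of_ne (by rintro rfl; omega)]
    simp
  · rw [hcol_step]
    rcases Nat.lt_succ_iff_lt_or_eq.mp hj with hlt | heq
    · rw [horth j hlt, mul_zero, zero_smul, sub_zero, h.col_mul j hlt]
    · obtain rfl : j = k := Fin.ext heq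
      rw [inv_mul_cancel₀ hne, one_smul, hu, sub_sub_cancel]

end Inverse

/-! ### The program

Array `0` holds `A`, the arrays `1` and `2` hold `p` and `ε`, array `3` the current weights, array
`4` the inverse of array `5`, array `10` the accumulated Gram matrices and array `11` the
iteration factor; the remaining arrays hold intermediate results. The registers `2`, `3`, `4`
are loop counters. -/

section Subroutines

variable {n d : ℕ} {ν : ℕ → ℕ} {ρ : Store}

/-- The registers `0` and `1` hold the dimensions, and the loop counters are zero. -/
structure Ready (n d : ℕ) (ν : ℕ → ℕ) : Prop where
  reg_zero : ν 0 = n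
  reg_one : ν 1 = d
  reg_two : ν 2 = 0
  reg_three : ν 3 = 0
  reg_four : ν 4 = 0
  rows_pos : 0 < n
  cols_pos : 0 < d

/-- Collapses every term of a cost polynomial into the single monomial `n * d ^ 3`. -/
theorem pow_mul_pow_le (hn : 0 < n) (hd : 0 < d) {a b : ℕ} (ha : a ≤ 1) (hb : b ≤ 3) :
    n ^ a * d ^ b ≤ n * d ^ 3 := by
  have := Nat.mul_le_mul (Nat.pow_le_pow_right hn ha) (Nat.pow_le_pow_right hd hb)
  rwa [pow_one] at this

/-- `array 5 := Aᵀ W ^ (1 - 2 / p) A`, where `W` is given by array `3`. -/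
def gramProgram : Program :=
  forLoop 2 1 (forLoop 3 1 (sumInto 5 (.reg 2) (.reg 3) 4 0
    (.mul (.mul (.pow (.get 3 (.reg 4) (.const 0))
      (.sub (.const 1) (.div (.const 2) (.get 1 (.const 0) (.const 0)))))
      (.get 0 (.reg 4) (.reg 2))) (.get 0 (.reg 4) (.reg 3)))))

theorem achieves_gramProgram {A : Matrix (Fin n) (Fin d) ℝ} {p : ℝ} {w : Fin n → ℝ}
    (hν : Ready n d ν) (hA : ∀ (i : Fin n) (j : Fin d), ρ 0 i j = A i j) (hp : ρ 1 0 0 = p)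
    (hw : ∀ i : Fin n, ρ 3 i 0 = w i) (hw0 : ∀ i, 0 ≤ w i) :
    Achieves gramProgram (100 * (n * d ^ 3)) ν ρ (fun ρ' => (∀ b, b ≠ 5 → ρ' b = ρ b) ∧
      ∀ j k : Fin d, ρ' 5 j k = LewisWeights.weightedGram A p w j k) := by
  obtain ⟨h0, h1, h2, h3, h4, hn, hd⟩ := hν
  -- The `if` reproduces the default value of `RExp.pow` at a negative base; nonnegativity of the
  -- weights discharges it at the end.
  refine (Achieves.fillMatrix (a := 5) (by decide) (by decide) (by decide) (by decide) h2 h3 h1 h1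
    hd hd (fun j k => ∑ i ∈ Finset.range n, (if 0 ≤ ρ 3 i 0 then ρ 3 i 0 ^ (1 - 2 / p) else 0) *
      ρ 0 i j * ρ 0 i k) fun j hj k hk ρ' hρ _ => Achieves.sumInto (by decide) (by simpa)
      (by simpa) hn (by simp [NExp.eval]) (by simp [NExp.eval]) _ ?_).mono ?_ ?_
  · intro i _ s
    simp [RExp.eval, NExp.eval, put_of_ne, hρ, hp]
  · simp only [NExp.cost, RExp.cost]
    have m1 := pow_mul_pow_le hn hd (a := 0) (b := 1) (by simp) (by simp)
    have m2 := pow_mul_pow_le hn hd (a := 0) (b := 2) (by simp) (by simp)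
    have m3 := pow_mul_pow_le hn hd (a := 1) (b := 2) (by simp) (by simp)
    linarith
  · rintro ρ' ⟨hb, hv⟩
    refine ⟨hb, fun j k => ?_⟩
    rw [hv j j.2 k k.2, LewisWeights.weightedGram_eq_gram, LewisWeights.gram_apply,
      Finset.sum_range]
    exact Finset.sum_congr rfl fun i _ => by rw [hw, hA, hA, if_pos (hw0 i)]

/-- The `k`-th step of the inversion, where `k` is the value of register `4`. -/
def inverseStepProgram : Program :=
  .seq (forLoop 2 1 (sumInto 6 (.reg 2) (.const 0) 3 1
    (.mul (.get 4 (.reg 2) (.reg 3)) (.get 5 (.reg 3) (.reg 4)))))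
  (.seq (.setReal 6 (.reg 4) (.const 0) (.sub (.get 6 (.reg 4) (.const 0)) (.const 1)))
  (.seq (sumInto 7 (.const 0) (.const 0) 3 1
    (.mul (.get 6 (.reg 3) (.const 0)) (.get 5 (.reg 3) (.reg 4))))
  (forLoop 2 1 (forLoop 3 1 (.setReal 4 (.reg 2) (.reg 3) (.sub (.get 4 (.reg 2) (.reg 3))
    (.mul (.div (.const 1) (.get 7 (.const 0) (.const 0)))
      (.mul (.get 6 (.reg 2) (.const 0)) (.get 6 (.reg 3) (.const 0))))))))))

theorem achieves_inverseStepProgram {X N : Matrix (Fin d) (Fin d) ℝ} (k : Fin d) (hd : 0 < d)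
    (h1 : ν 1 = d) (h2 : ν 2 = 0) (h3 : ν 3 = 0) (h4 : ν 4 = k)
    (hX : ∀ i j : Fin d, ρ 5 i j = X i j) (hN : ∀ i j : Fin d, ρ 4 i j = N i j) :
    Achieves inverseStepProgram (200 * d ^ 2) ν ρ
      (fun ρ' => (∀ b, b ≠ 4 → b ≠ 6 → b ≠ 7 → ρ' b = ρ b) ∧
        ∀ i j : Fin d, ρ' 4 i j = inverseStep X k N i j) := by
  set u := (N * X).col k - Pi.single k 1 with hu
  refine (Achieves.seq (c₁ := d * (d * 34 + 16)) (c₂ := 10 + (d * 34 + d * (d * (24 + 16) + 16)))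
    (Q₁ := fun ρ' => (∀ b, b ≠ 6 → ρ' b = ρ b) ∧
      ∀ i : Fin d, ρ' 6 i 0 = (N * X) i k) ?_ fun ρ₁ ⟨hb₁, hρ₁⟩ =>
    Achieves.seq (c₁ := 10) (c₂ := d * 34 + d * (d * (24 + 16) + 16)) (Q₁ := fun ρ' => (∀ b, b ≠ 6 → ρ' b = ρ b) ∧ ∀ i : Fin d, ρ' 6 i 0 = u i)
      (Achieves.setReal.mono (by simp [NExp.cost, RExp.cost]) ?_) fun ρ₂ ⟨hb₂, hρ₂⟩ =>
    Achieves.seq (c₁ := d * 34) (c₂ := d * (d * (24 + 16) + 16)) (Q₁ := fun ρ' => (∀ b, b ≠ 6 → b ≠ 7 → ρ' b = ρ b) ∧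
      (∀ i : Fin d, ρ' 6 i 0 = u i) ∧ ρ' 7 0 0 = u ⬝ᵥ X.col k) ?_ fun ρ₃ ⟨hb₃, hu₃, hs₃⟩ =>
    ?_).mono ?_ fun _ h => h
  · refine (Achieves.fillColumn (a := 6) (c := d * 34) (by decide) h2 h1 hd
      (fun i => ∑ j ∈ Finset.range d, ρ 4 i j * ρ 5 j k) fun i hi ρ' hρ _ =>
        (Achieves.sumInto (by decide) (by simpa) (by simpa) hd (by simp [NExp.eval])
        (by simp [NExp.eval]) _ ?_).mono (by simp [NExp.cost, RExp.cost]) fun _ h => h).mono le_rfl ?_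
    · intro j _ s
      simp [RExp.eval, NExp.eval, put_of_ne, hρ, h4]
    · rintro ρ' ⟨hb, hv⟩
      refine ⟨hb, fun i => ?_⟩
      rw [hv i i.2, Finset.sum_range, mul_apply]
      exact Finset.sum_congr rfl fun j _ => by rw [hN, hX]
  · rintro _ rfl
    refine ⟨fun b hb => by rw [put_of_ne _ hb, hb₁ b hb], fun i => ?_⟩
    simp only [RExp.eval, NExp.eval, h4, put_apply, Fin.val_inj, and_true, hρ₁, hu, Pi.sub_apply,
      col_apply, Pi.single_apply]
    split_ifs with h <;> simp [h]
  · refine (Achieves.sumInto (N := d) (I := 0) (J := 0) (by decide) h3 h1 hd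
      (by simp [NExp.eval]) (by simp [NExp.eval]) (fun j => ρ₂ 6 j 0 * ρ₂ 5 j k) ?_).mono
      (by simp [NExp.cost, RExp.cost]) ?_
    · intro j _ s
      simp [RExp.eval, NExp.eval, put_of_ne, h4]
    · rintro _ rfl
      refine ⟨fun b hb hb' => by rw [put_of_ne _ hb', hb₂ b hb], fun i => ?_, ?_⟩
      · rw [put_of_ne _ (by decide), hρ₂]
      · rw [put_self, Finset.sum_range]
        exact Finset.sum_congr rfl fun j _ => by rw [hρ₂, hb₂ 5 (by decide), hX, col_apply]
  · refine (Achieves.fillMatrix (a := 4) (c := 24) (by decide) (by decide) (by decide) (by decide)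
      h2 h3 h1 h1 hd hd (fun i j => ρ₃ 4 i j - 1 / ρ₃ 7 0 0 * (ρ₃ 6 i 0 * ρ₃ 6 j 0))
      fun i hi j hj ρ' hρ hρ' => Achieves.setReal.mono (by simp [NExp.cost, RExp.cost]) ?_).mono
      le_rfl ?_
    · rintro _ rfl
      simp [RExp.eval, NExp.eval, hρ, hρ']
    · rintro ρ' ⟨hb, hv⟩
      refine ⟨fun b h4 h6 h7 => by rw [hb b h4, hb₃ b h6 h7], fun i j => ?_⟩
      rw [hv i i.2 j j.2, hb₃ 4 (by decide) (by decide), hN, hs₃, hu₃, hu₃, inverseStep, one_div,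
        Matrix.sub_apply, Matrix.smul_apply, vecMulVec_apply, smul_eq_mul]
  · nlinarith

/-- `array 4 := X⁻¹`, where `X` is given by array `5`. -/
def inverseProgram : Program :=
  .seq (forLoop 2 1 (forLoop 3 1 (.setReal 4 (.reg 2) (.reg 3) (.const 0))))
    (forLoop 4 1 inverseStepProgram)

theorem achieves_inverseProgram {X : Matrix (Fin d) (Fin d) ℝ} (hν : Ready n d ν)
    (hX : ∀ i j : Fin d, ρ 5 i j = X i j) (hPD : X.PosDef) :
    Achieves inverseProgram (300 * (n * d ^ 3)) ν ρ
      (fun ρ' => (∀ b, b ≠ 4 → b ≠ 6 → b ≠ 7 → ρ' b = ρ b) ∧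
        ∀ i j : Fin d, ρ' 4 i j = X⁻¹ i j) := by
  obtain ⟨h0, h1, h2, h3, h4, hn, hd⟩ := hν
  have H := Achieves.seq (ν := ν) (ρ := ρ) (Achieves.fillMatrix (a := 4) (x := 2) (y := 3)
    (rx := 1) (ry := 1) (body := .setReal 4 (.reg 2) (.reg 3) (.const 0))
    (by decide) (by decide) (by decide) (by decide) h2 h3 h1 h1 hd hd (fun _ _ => 0)
    fun i _ j _ ρ' _ _ => Achieves.setReal.mono le_rfl fun ρ'' h => by
      simpa [RExp.eval, NExp.eval] using h) fun ρ₁ ⟨hb₁, hρ₁⟩ =>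
    Achieves.forLoop (x := 4) (y := 1) (body := inverseStepProgram) (c := 200 * d ^ 2)
      (by decide) h4 (h1 ▸ hd)
      (fun k ρ' => (∀ b, b ≠ 4 → b ≠ 6 → b ≠ 7 → ρ' b = ρ b) ∧
        ∃ N : Matrix (Fin d) (Fin d) ℝ, (∀ i j : Fin d, ρ' 4 i j = N i j) ∧
          IsPartialInverse X k N)
      ⟨fun b hb _ _ => hb₁ b hb, 0, fun i j => by simp [hρ₁ i i.2 j j.2],
        isPartialInverse_zero X⟩ fun k hk ρ' ⟨hb, N, hN, hpart⟩ => by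
      rw [h1] at hk
      refine (achieves_inverseStepProgram (N := N) (X := X) ⟨k, hk⟩ hd
        (by simpa) (by simpa) (by simpa) (by simp)
        (fun i j => by rw [hb 5 (by decide) (by decide) (by decide), hX]) hN).mono le_rfl ?_
      rintro ρ'' ⟨hb', hN'⟩
      exact ⟨fun b h h' h'' => by rw [hb' b h h' h'', hb b h h' h''], _, hN',
        hpart.step (k := ⟨k, hk⟩) hPD⟩
  refine H.mono ?_ ?_
  · simp only [NExp.cost, RExp.cost, h1]
    have m1 := pow_mul_pow_le hn hd (a := 0) (b := 1) (by simp) (by simp)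
    have m2 := pow_mul_pow_le hn hd (a := 0) (b := 2) (by simp) (by simp)
    have m3 := pow_mul_pow_le hn hd (a := 0) (b := 3) (by simp) (by simp)
    linarith
  · rintro ρ' ⟨hb, N, hN, hpart⟩
    rw [h1] at hpart
    exact ⟨hb, fun i j => by rw [hN, hpart.eq_inv]⟩

/-- `array 9 [i] := aᵢᵀ M aᵢ`, where `M` is given by array `4`. -/
def quadProgram : Program :=
  .seq (forLoop 2 0 (forLoop 3 1 (sumInto 8 (.reg 2) (.reg 3) 4 1
    (.mul (.get 4 (.reg 3) (.reg 4)) (.get 0 (.reg 2) (.reg 4))))))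
  (forLoop 2 0 (sumInto 9 (.reg 2) (.const 0) 3 1
    (.mul (.get 0 (.reg 2) (.reg 3)) (.get 8 (.reg 2) (.reg 3)))))

theorem achieves_quadProgram {A : Matrix (Fin n) (Fin d) ℝ} {M : Matrix (Fin d) (Fin d) ℝ}
    (hν : Ready n d ν) (hA : ∀ (i : Fin n) (j : Fin d), ρ 0 i j = A i j)
    (hM : ∀ i j : Fin d, ρ 4 i j = M i j) :
    Achieves quadProgram (200 * (n * d ^ 3)) ν ρ (fun ρ' => (∀ b, b ≠ 8 → b ≠ 9 → ρ' b = ρ b) ∧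
      ∀ i : Fin n, ρ' 9 i 0 = A i ⬝ᵥ M *ᵥ A i) := by
  obtain ⟨h0, h1, h2, h3, h4, hn, hd⟩ := hν
  refine (Achieves.seq (c₁ := n * (d * (d * 34 + 16) + 16)) (c₂ := n * (d * 34 + 16))
    (Q₁ := fun ρ' => (∀ b, b ≠ 8 → ρ' b = ρ b) ∧
      ∀ (i : Fin n) (j : Fin d), ρ' 8 i j = (M *ᵥ A i) j) ?_ fun ρ₁ ⟨hb₁, hρ₁⟩ => ?_).mono
      ?_ fun ρ' h => h
  · refine (Achieves.fillMatrix (a := 8) (c := d * 34) (by decide) (by decide) (by decide)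
      (by decide) h2 h3 h0 h1 hn hd (fun i j => ∑ k ∈ Finset.range d, ρ 4 j k * ρ 0 i k)
      fun i _ j _ ρ' hρ _ => (Achieves.sumInto (by decide) (by simpa) (by simpa) hd
        (by simp [NExp.eval]) (by simp [NExp.eval]) _ ?_).mono
        (by simp [NExp.cost, RExp.cost]) fun _ h => h).mono le_rfl ?_
    · intro k _ s
      simp [RExp.eval, NExp.eval, put_of_ne, hρ]
    · rintro ρ' ⟨hb, hv⟩
      refine ⟨hb, fun i j => ?_⟩
      rw [hv i i.2 j j.2, Finset.sum_range]
      exact Finset.sum_congr rfl fun k _ => by rw [hM, hA]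
  · refine (Achieves.fillColumn (a := 9) (c := d * 34) (by decide) h2 h0 hn
      (fun i => ∑ j ∈ Finset.range d, ρ₁ 0 i j * ρ₁ 8 i j) fun i _ ρ' hρ _ =>
        (Achieves.sumInto (by decide) (by simpa) (by simpa) hd (by simp [NExp.eval])
        (by simp [NExp.eval]) _ ?_).mono (by simp [NExp.cost, RExp.cost]) fun _ h => h).mono le_rfl ?_
    · intro j _ s
      simp [RExp.eval, NExp.eval, put_of_ne, hρ]
    · rintro ρ' ⟨hb, hv⟩
      refine ⟨fun b h8 h9 => by rw [hb b h9, hb₁ b h8], fun i => ?_⟩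
      rw [hv i i.2, Finset.sum_range]
      exact Finset.sum_congr rfl fun j _ => by rw [hρ₁, hb₁ 0 (by decide), hA]
  · have m1 := pow_mul_pow_le hn hd (a := 1) (b := 0) (by simp) (by simp)
    have m2 := pow_mul_pow_le hn hd (a := 1) (b := 1) (by simp) (by simp)
    have m3 := pow_mul_pow_le hn hd (a := 1) (b := 2) (by simp) (by simp)
    linarith

end Subroutines

end RealRAM

namespace RealRAM

open Matrix

/-! ### The main loop -/

section Main

variable {n d : ℕ} {ν : ℕ → ℕ} {ρ : Store}

/-- The contents of the arrays after `k` iterations. -/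
structure LoopInvariant (A : Matrix (Fin n) (Fin d) ℝ) (p κ : ℝ) (k : ℕ) (ρ : Store) : Prop where
  matrix : ∀ (i : Fin n) (j : Fin d), ρ 0 i j = A i j
  exponent : ρ 1 0 0 = p
  factor : ρ 11 0 0 = κ
  weights : ∀ i : Fin n, ρ 3 i 0 = LewisWeights.lewisIter A p k i
  total : ∀ j l : Fin d, ρ 10 j l =
    (∑ m ∈ Finset.range k, LewisWeights.weightedGram A p (LewisWeights.lewisIter A p m)) j l

/-- `array 10 := array 10 + array 5`. -/
def accumulateProgram : Program :=
  forLoop 2 1 (forLoop 3 1 (.setReal 10 (.reg 2) (.reg 3)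
    (.add (.get 10 (.reg 2) (.reg 3)) (.get 5 (.reg 2) (.reg 3)))))

theorem achieves_accumulateProgram (hν : Ready n d ν) :
    Achieves accumulateProgram (100 * (n * d ^ 3)) ν ρ (fun ρ' => (∀ b, b ≠ 10 → ρ' b = ρ b) ∧
      ∀ i j : Fin d, ρ' 10 i j = ρ 10 i j + ρ 5 i j) := by
  obtain ⟨h0, h1, h2, h3, h4, hn, hd⟩ := hν
  refine (Achieves.fillMatrix (a := 10) (c := 10) (by decide) (by decide) (by decide) (by decide)
    h2 h3 h1 h1 hd hd (fun i j => ρ 10 i j + ρ 5 i j) fun i _ j _ ρ' hρ hρ' =>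
      Achieves.setReal.mono (by simp [NExp.cost, RExp.cost]) ?_).mono ?_ ?_
  · rintro _ rfl
    simp [RExp.eval, NExp.eval, hρ, hρ']
  · have m1 := pow_mul_pow_le hn hd (a := 0) (b := 1) (by simp) (by simp)
    have m2 := pow_mul_pow_le hn hd (a := 0) (b := 2) (by simp) (by simp)
    linarith
  · exact fun ρ' ⟨hb, hv⟩ => ⟨hb, fun i j => hv i i.2 j j.2⟩

/-- `array 3 [i] := array 3 [i] ^ (1 - 2 / p) * array 9 [i]`. -/
def reweightProgram : Program :=
  forLoop 2 0 (.setReal 3 (.reg 2) (.const 0) (.mul (.pow (.get 3 (.reg 2) (.const 0))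
    (.sub (.const 1) (.div (.const 2) (.get 1 (.const 0) (.const 0)))))
      (.get 9 (.reg 2) (.const 0))))

theorem achieves_reweightProgram (hν : Ready n d ν) {p : ℝ} (hp : ρ 1 0 0 = p)
    (hw : ∀ i : Fin n, 0 ≤ ρ 3 i 0) :
    Achieves reweightProgram (100 * (n * d ^ 3)) ν ρ (fun ρ' => (∀ b, b ≠ 3 → ρ' b = ρ b) ∧
      ∀ i : Fin n, ρ' 3 i 0 = ρ 3 i 0 ^ (1 - 2 / p) * ρ 9 i 0) := by
  obtain ⟨h0, h1, h2, h3, h4, hn, hd⟩ := hν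
  refine (Achieves.fillColumn (a := 3) (c := 18) (by decide) h2 h0 hn
    (fun i => ρ 3 i 0 ^ (1 - 2 / p) * ρ 9 i 0) fun i hi ρ' hρ hρ' =>
      Achieves.setReal.mono (by simp [NExp.cost, RExp.cost]) ?_).mono ?_ ?_
  · rintro _ rfl
    have := hw ⟨i, hi⟩
    simp only at this
    simp [RExp.eval, NExp.eval, hρ, hρ', hp, this]
  · have m1 := pow_mul_pow_le hn hd (a := 1) (b := 0) (by simp) (by simp)
    linarith
  · exact fun ρ' ⟨hb, hv⟩ => ⟨hb, fun i => hv i i.2⟩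

/-- One iteration. -/
def iterationProgram : Program :=
  .seq gramProgram (.seq accumulateProgram (.seq inverseProgram (.seq quadProgram reweightProgram)))

/-- The Gram matrix is accumulated before the weights are replaced, so the total after `k + 1`
rounds covers the iterates `0, …, k`. -/
theorem achieves_iterationProgram {A : Matrix (Fin n) (Fin d) ℝ} {p κ : ℝ} {k : ℕ}
    (hν : Ready n d ν) (hA : A.rank = d) (hρ : LoopInvariant A p κ k ρ) :
    Achieves iterationProgram (800 * (n * d ^ 3)) ν ρ (LoopInvariant A p κ (k + 1)) := by
  have hw := (LewisWeights.lewisIter_nonneg_pos (p := p) hν.cols_pos hA k).1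
  have hPD := LewisWeights.lewisIter_posDef (p := p) hν.cols_pos hA k
  refine (Achieves.seq (achieves_gramProgram hν hρ.matrix hρ.exponent hρ.weights hw)
    fun ρ₁ ⟨hb₁, hv₁⟩ => Achieves.seq (achieves_accumulateProgram hν) fun ρ₂ ⟨hb₂, hv₂⟩ =>
    Achieves.seq (achieves_inverseProgram hν (fun i j => ?_) hPD) fun ρ₃ ⟨hb₃, hv₃⟩ =>
    Achieves.seq (achieves_quadProgram hν (A := A) (fun i j => ?_) hv₃) fun ρ₄ ⟨hb₄, hv₄⟩ =>
    (achieves_reweightProgram hν (p := p) ?_ fun i => ?_).mono le_rfl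
      fun ρ₅ ⟨hb₅, hv₅⟩ => ?_).mono ?_ fun _ h => h
  · rw [hb₂ 5 (by decide), hv₁]
  · rw [hb₃ 0 (by decide) (by decide) (by decide), hb₂ 0 (by decide), hb₁ 0 (by decide), hρ.matrix]
  · rw [hb₄ 1 (by decide) (by decide), hb₃ 1 (by decide) (by decide) (by decide),
      hb₂ 1 (by decide), hb₁ 1 (by decide), hρ.exponent]
  · rw [hb₄ 3 (by decide) (by decide), hb₃ 3 (by decide) (by decide) (by decide),
      hb₂ 3 (by decide), hb₁ 3 (by decide), hρ.weights]
    exact hw i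
  · linarith
  · have hb : ∀ b, b ≠ 3 → b ≠ 4 → b ≠ 5 → b ≠ 6 → b ≠ 7 → b ≠ 8 → b ≠ 9 → b ≠ 10 →
        ρ₅ b = ρ b := fun b h3 h4 h5 h6 h7 h8 h9 h10 => by
      rw [hb₅ b h3, hb₄ b h8 h9, hb₃ b h4 h6 h7, hb₂ b h10, hb₁ b h5]
    constructor
    · intro i j; rw [hb 0 (by decide) (by decide) (by decide) (by decide) (by decide) (by decide)
        (by decide) (by decide), hρ.matrix]
    · rw [hb 1 (by decide) (by decide) (by decide) (by decide) (by decide) (by decide)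
        (by decide) (by decide), hρ.exponent]
    · rw [hb 11 (by decide) (by decide) (by decide) (by decide) (by decide) (by decide)
        (by decide) (by decide), hρ.factor]
    · intro i
      rw [hv₅, hv₄, hb₄ 3 (by decide) (by decide), hb₃ 3 (by decide) (by decide) (by decide),
        hb₂ 3 (by decide), hb₁ 3 (by decide), hρ.weights]
      rfl
    · intro j l
      rw [hb₅ 10 (by decide), hb₄ 10 (by decide) (by decide),
        hb₃ 10 (by decide) (by decide) (by decide), hv₂, hb₁ 10 (by decide), hρ.total, hv₁,
        Finset.sum_range_succ, Matrix.add_apply]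

/-- The output phase. -/
def outputProgram : Program :=
  .seq (forLoop 2 1 (forLoop 3 1 (.setReal 5 (.reg 2) (.reg 3)
    (.div (.get 10 (.reg 2) (.reg 3)) (.ofNat (.reg 7))))))
  (.seq inverseProgram (.seq quadProgram
  (forLoop 2 0 (.setReal 3 (.reg 2) (.const 0) (.pow (.get 9 (.reg 2) (.const 0))
    (.div (.get 1 (.const 0) (.const 0)) (.const 2)))))))

theorem achieves_outputProgram {A : Matrix (Fin n) (Fin d) ℝ} {p κ : ℝ} {T : ℕ}
    (hν : Ready n d ν) (hT : ν 7 = T) (hT0 : 0 < T) (hA : A.rank = d)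
    (hρ : LoopInvariant A p κ T ρ) :
    Achieves outputProgram (800 * (n * d ^ 3)) ν ρ (fun ρ' =>
      (∀ i : Fin n, ρ' 3 i 0 =
        (A i ⬝ᵥ (LewisWeights.averageGram A p T)⁻¹ *ᵥ A i) ^ (p / 2)) ∧
      ∀ i j : Fin d, ρ' 4 i j = (LewisWeights.averageGram A p T)⁻¹ i j) := by
  have hPD := LewisWeights.averageGram_posDef (p := p) hν.cols_pos hA hT0
  obtain ⟨h0, h1, h2, h3, h4, hn, hd⟩ := id hν
  refine (Achieves.seq (c₁ := d * (d * (10 + 16) + 16))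
    (c₂ := 300 * (n * d ^ 3) + (200 * (n * d ^ 3) + n * (12 + 16)))
    (Q₁ := fun ρ' => (∀ b, b ≠ 5 → ρ' b = ρ b) ∧
      ∀ i j : Fin d, ρ' 5 i j = LewisWeights.averageGram A p T i j) ?_ fun ρ₁ ⟨hb₁, hv₁⟩ =>
    Achieves.seq (achieves_inverseProgram hν hv₁ hPD) fun ρ₂ ⟨hb₂, hv₂⟩ =>
    Achieves.seq (achieves_quadProgram hν (A := A) (fun i j => ?_) hv₂) fun ρ₃ ⟨hb₃, hv₃⟩ =>
    ?_).mono ?_ fun _ h => h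
  · refine (Achieves.fillMatrix (a := 5) (c := 10) (by decide) (by decide) (by decide) (by decide)
      h2 h3 h1 h1 hd hd (fun i j => ρ 10 i j / T) fun i _ j _ ρ' hρ' _ =>
        Achieves.setReal.mono (by simp [NExp.cost, RExp.cost]) ?_).mono le_rfl ?_
    · rintro _ rfl
      simp [RExp.eval, NExp.eval, hρ', hT]
    · refine fun ρ' ⟨hb, hv⟩ => ⟨hb, fun i j => ?_⟩
      rw [hv i i.2 j j.2, hρ.total, LewisWeights.averageGram, Matrix.smul_apply, smul_eq_mul,
        inv_mul_eq_div]
  · rw [hb₂ 0 (by decide) (by decide) (by decide), hb₁ 0 (by decide), hρ.matrix]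
  · have hp : ρ₃ 1 0 0 = p := by
      rw [hb₃ 1 (by decide) (by decide), hb₂ 1 (by decide) (by decide) (by decide),
        hb₁ 1 (by decide), hρ.exponent]
    refine (Achieves.fillColumn (a := 3) (c := 12) (by decide) h2 h0 hn
      (fun i => ρ₃ 9 i 0 ^ (p / 2)) fun i hi ρ' hρ' _ =>
        Achieves.setReal.mono (by simp [NExp.cost, RExp.cost]) ?_).mono le_rfl ?_
    · rintro _ rfl
      have : 0 ≤ ρ₃ 9 i 0 := by
        have := hv₃ ⟨i, hi⟩
        simp only at this
        rw [this]
        exact LewisWeights.quad_nonneg hPD.inv.posSemidef _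
      simp [RExp.eval, NExp.eval, hρ', hp, this]
    · refine fun ρ' ⟨hb, hv⟩ => ⟨fun i => ?_, fun i j => ?_⟩
      · rw [hv i i.2, hv₃]
      · rw [hb 4 (by decide), hb₃ 4 (by decide) (by decide), hv₂]
  · have m1 := pow_mul_pow_le hn hd (a := 0) (b := 1) (by simp) (by simp)
    have m2 := pow_mul_pow_le hn hd (a := 0) (b := 2) (by simp) (by simp)
    have m3 := pow_mul_pow_le hn hd (a := 1) (b := 0) (by simp) (by simp)
    linarith

/-- Uniform initial weights, and the iteration factor. -/
def initProgram : Program :=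
  .seq (forLoop 2 0 (.setReal 3 (.reg 2) (.const 0) (.div (.ofNat (.reg 1)) (.ofNat (.reg 0)))))
  (.setReal 11 (.const 0) (.const 0) (.add (.const 1) (.div (.const 2)
    (.sub (.add
      (.pow (.add (.const 1) (.get 2 (.const 0) (.const 0)))
        (.div (.const 2) (.get 1 (.const 0) (.const 0))))
      (.div (.const 1) (.pow (.add (.const 1) (.get 2 (.const 0) (.const 0)))
        (.div (.const 2) (.get 1 (.const 0) (.const 0)))))) (.const 2)))))

theorem achieves_initProgram (A : Matrix (Fin n) (Fin d) ℝ) (p : ℝ) {ε : ℝ} (hε : 0 < ε)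
    (hν : Ready n d ν) : Achieves initProgram (100 * (n * d ^ 3)) ν (input A p ε).real
      (LoopInvariant A p (LewisWeights.iterationFactor p ε) 0) := by
  obtain ⟨h0, h1, h2, h3, h4, hn, hd⟩ := hν
  refine (Achieves.seq (c₁ := n * (8 + 16)) (c₂ := 40) (Achieves.fillColumn (a := 3) (c := 8)
    (by decide) h2 h0 hn (fun _ => (d / n : ℝ)) fun i hi ρ' hρ _ =>
      Achieves.setReal.mono (by simp [NExp.cost, RExp.cost]) ?_) fun ρ₁ ⟨hb₁, hv₁⟩ =>
    Achieves.setReal.mono (by simp [NExp.cost, RExp.cost]) ?_).mono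
      ?_ fun _ h => h
  · rintro _ rfl
    simp [RExp.eval, NExp.eval, h0, h1]
  · have m3 := pow_mul_pow_le hn hd (a := 1) (b := 0) (by simp) (by simp)
    have m0 := pow_mul_pow_le hn hd (a := 0) (b := 0) (by simp) (by simp)
    linarith
  · rintro _ rfl
    have hε' : 0 ≤ 1 + ε := by linarith
    constructor
    · intro i j; rw [put_of_ne _ (by decide), hb₁ 0 (by decide)]; simp [input]
    · rw [put_of_ne _ (by decide), hb₁ 1 (by decide)]; simp [input]
    · simp [RExp.eval, NExp.eval, put_self, hb₁, input, hε', LewisWeights.iterationFactor]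
    · intro i; rw [put_of_ne _ (by decide), hv₁ i i.2]; rfl
    · intro j l; rw [put_of_ne _ (by decide), hb₁ 10 (by decide)]; simp [input]

/-- Register `5` becomes the least `L` with `n ≤ 2 ^ L`. -/
def logProgram : Program :=
  .seq (.setNat 6 (.const 1)) (.loop (.neg (.natLe (.reg 0) (.reg 6)))
    (.seq (.setNat 6 (.add (.reg 6) (.reg 6))) (.setNat 5 (.add (.reg 5) (.const 1)))))

/-- The machine has neither logarithms nor rounding; repeated doubling supplies an integer
substitute for `log n`. -/
theorem exists_runs_logProgram (A : Matrix (Fin n) (Fin d) ℝ) (p ε : ℝ) (hn : 0 < n)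
    (hd : 0 < d) : ∃ t τ, t ≤ 13 * Nat.clog 2 n + 7 ∧ Runs logProgram (input A p ε) t τ ∧
      Ready n d τ.nat ∧ τ.nat 5 = Nat.clog 2 n ∧ τ.nat 7 = 0 ∧
      τ.real = (input A p ε).real := by
  obtain ⟨t, τ, ht, hr, hI⟩ := exists_runs_loop (b := .neg (.natLe (.reg 0) (.reg 6)))
    (P := .seq (.setNat 6 (.add (.reg 6) (.reg 6))) (.setNat 5 (.add (.reg 5) (.const 1))))
    (c := 8) (N := Nat.clog 2 n) (fun k σ => Ready n d σ.nat ∧ σ.nat 5 = k ∧ σ.nat 6 = 2 ^ k ∧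
      σ.nat 7 = 0 ∧ σ.real = (input A p ε).real)
    (by
      rintro k hk σ ⟨hR, h5, h6, h7, hr⟩
      refine ⟨?_, _, _, ?_, .seq (.setNat _ _ _) (.setNat _ _ _), ?_, ?_, ?_, ?_, hr⟩
      · simpa [BExp.eval, NExp.eval, hR.reg_zero, h6] using
          (Nat.lt_clog_iff_pow_lt (by decide)).mp hk
      · simp [NExp.cost]
      · obtain ⟨h0, h1, h2, h3, h4, -, -⟩ := hR
        constructor <;> simp [State.setNat, *]
      · simp [State.setNat, NExp.eval, h5]
      · simp [State.setNat, NExp.eval, h6]; ring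
      · simp [State.setNat, h7])
    (by
      rintro σ ⟨hR, h5, h6, h7, hr⟩
      simpa [BExp.eval, NExp.eval, hR.reg_zero, h6] using Nat.le_pow_clog (by decide) n)
    (σ := (input A p ε).setNat 6 1)
    ⟨by constructor <;> simp [State.setNat, input, hn, hd], by simp [State.setNat, input],
      by simp [State.setNat], by simp [State.setNat, input], rfl⟩
  refine ⟨_, τ, ?_, .seq (.setNat _ _ _) hr, hI.1, hI.2.1, hI.2.2.2.1, hI.2.2.2.2⟩
  simp only [BExp.cost, NExp.cost] at ht ⊢
  omega

/-- The main loop; register `7` counts the iterations. -/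
def mainLoop : Program :=
  .loop (.realLe (.ofNat (.reg 7)) (.mul (.get 11 (.const 0) (.const 0))
    (.mul (.ofNat (.reg 1)) (.ofNat (.add (.reg 5) (.const 1))))))
    (.seq iterationProgram (.setNat 7 (.add (.reg 7) (.const 1))))

/-- The test compares the integer counter with a real bound, so the floor occurs only in the
analysis. As equality still continues, the loop stops at the floor plus one. -/
theorem exists_runs_mainLoop {A : Matrix (Fin n) (Fin d) ℝ} {p κ : ℝ} (hA : A.rank = d) {L T : ℕ}
    (hκ : 0 ≤ κ) (hT : T = ⌊κ * (d * ((L + 1 : ℕ) : ℝ))⌋₊ + 1) {σ : State} (hR : Ready n d σ.nat)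
    (h5 : σ.nat 5 = L) (h7 : σ.nat 7 = 0) (hσ : LoopInvariant A p κ 0 σ.real) :
    ∃ t τ, t ≤ T * (900 * (n * d ^ 3)) + 20 ∧ Runs mainLoop σ t τ ∧
      Ready n d τ.nat ∧ τ.nat 7 = T ∧ LoopInvariant A p κ T τ.real := by
  have hX : 1 ≤ n * d ^ 3 := pow_mul_pow_le hR.rows_pos hR.cols_pos (a := 0) (b := 0) (by simp)
    (by simp)
  obtain ⟨t, τ, ht, hr, hI⟩ := exists_runs_loop
    (b := .realLe (.ofNat (.reg 7)) (.mul (.get 11 (.const 0) (.const 0))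
      (.mul (.ofNat (.reg 1)) (.ofNat (.add (.reg 5) (.const 1))))))
    (P := .seq iterationProgram (.setNat 7 (.add (.reg 7) (.const 1))))
    (c := 800 * (n * d ^ 3) + 4) (N := T) (fun k σ => Ready n d σ.nat ∧ σ.nat 5 = L ∧
      σ.nat 7 = k ∧ LoopInvariant A p κ k σ.real)
    (by
      rintro k hk ⟨ν, ρ⟩ ⟨hR, h5, h7, hI⟩
      simp only at hR h5 h7 hI
      obtain ⟨t, ρ', ht, hr, hI'⟩ := achieves_iterationProgram hR hA hI
      refine ⟨?_, _, _, ?_, .seq hr (.setNat _ _ _), ?_, ?_, ?_, hI'⟩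
      · have hk' : k ≤ ⌊κ * (d * ((L + 1 : ℕ) : ℝ))⌋₊ := by omega
        have := (Nat.le_floor_iff (by positivity)).mp hk'
        simpa [BExp.eval, RExp.eval, NExp.eval, h5, h7, hR.reg_one, hI.factor] using this
      · simp only [NExp.cost]; omega
      · obtain ⟨h0, h1, h2, h3, h4, hn, hd⟩ := hR
        constructor <;> simp [State.setNat, *]
      · simp [State.setNat, h5]
      · simp [State.setNat, NExp.eval, h7])
    (by
      rintro ⟨ν, ρ⟩ ⟨hR, h5, h7, hI⟩
      simp only at hR h5 h7 hI
      have := Nat.lt_floor_add_one (κ * (d * ((L + 1 : ℕ) : ℝ)))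
      have hT' : (T : ℝ) = ⌊κ * (d * ((L + 1 : ℕ) : ℝ))⌋₊ + 1 := by exact_mod_cast hT
      rw [← hT'] at this
      simpa [BExp.eval, RExp.eval, NExp.eval, h5, h7, hR.reg_one, hI.factor] using this)
    (σ := σ) ⟨hR, h5, h7, hσ⟩
  refine ⟨t, τ, ht.trans ?_, hr, hI.1, hI.2.2.1, hI.2.2.2⟩
  simp only [BExp.cost, RExp.cost, NExp.cost]
  refine Nat.add_le_add (Nat.mul_le_mul_left _ ?_) (by norm_num)
  omega

/-- The program computing approximate Lewis weights and an approximate Lewis quadratic form. -/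
def lewisProgram : Program :=
  .seq logProgram (.seq initProgram (.seq mainLoop outputProgram))

theorem exists_runs_lewisProgram {A : Matrix (Fin n) (Fin d) ℝ} {p ε : ℝ} (hp : 2 ≤ p)
    (hε : 0 < ε) (hd : 0 < d) (hA : A.rank = d) {T : ℕ}
    (hT : T = ⌊LewisWeights.iterationFactor p ε * (d * ((Nat.clog 2 n + 1 : ℕ) : ℝ))⌋₊ + 1) :
    ∃ t τ, t ≤ T * (2000 * (n * d ^ 3)) ∧ Runs lewisProgram (input A p ε) t τ ∧
      (∀ i : Fin n, outputVector τ n i =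
        (A i ⬝ᵥ (LewisWeights.averageGram A p T)⁻¹ *ᵥ A i) ^ (p / 2)) ∧
      outputMatrix τ d = (LewisWeights.averageGram A p T)⁻¹ := by
  have hn := LewisWeights.pos_of_rank hd hA
  have hκ := LewisWeights.one_le_iterationFactor hp hε
  have hX : 1 ≤ n * d ^ 3 := pow_mul_pow_le hn hd (a := 0) (b := 0) (by simp) (by simp)
  obtain ⟨t₁, ⟨ν₁, ρ₁⟩, ht₁, hr₁, hR₁, h5, h7, hρ₁⟩ := exists_runs_logProgram A p ε hn hd
  simp only at hR₁ h5 h7 hρ₁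
  subst hρ₁
  obtain ⟨t₂, ρ₂, ht₂, hr₂, hI₂⟩ := achieves_initProgram A p hε hR₁
  obtain ⟨t₃, ⟨ν₃, ρ₃⟩, ht₃, hr₃, hR₃, hT₃, hI₃⟩ := exists_runs_mainLoop hA (by linarith) hT
    (σ := ⟨ν₁, ρ₂⟩) hR₁ h5 h7 hI₂
  simp only at hR₃ hT₃ hI₃
  obtain ⟨t₄, ρ₄, ht₄, hr₄, hw, hM⟩ := achieves_outputProgram hR₃ hT₃ (by omega) hA hI₃
  refine ⟨_, _, ?_, .seq hr₁ (.seq hr₂ (.seq hr₃ hr₄)), hw, by ext i j; exact hM i j⟩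
  -- Lets the cost of computing the logarithm be charged to the main loop.
  have hLT : Nat.clog 2 n + 1 ≤ T := by
    rw [hT]
    refine (Nat.le_floor ?_).trans (Nat.le_succ _)
    have hd1 : (1 : ℝ) ≤ d := by exact_mod_cast hd
    have hL : (0 : ℝ) ≤ ((Nat.clog 2 n + 1 : ℕ) : ℝ) := by positivity
    calc ((Nat.clog 2 n + 1 : ℕ) : ℝ) ≤ d * ((Nat.clog 2 n + 1 : ℕ) : ℝ) :=
          le_mul_of_one_le_left hL hd1
      _ ≤ _ := le_mul_of_one_le_left (by positivity) hκ
  have hTX : T ≤ T * (n * d ^ 3) := Nat.le_mul_of_pos_right _ hX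
  have hXT : n * d ^ 3 ≤ T * (n * d ^ 3) := Nat.le_mul_of_pos_left _ (by omega)
  have e : T * (900 * (n * d ^ 3)) = 900 * (T * (n * d ^ 3)) := by ring
  have e' : T * (2000 * (n * d ^ 3)) = 2000 * (T * (n * d ^ 3)) := by ring
  omega

/-! ### Logarithm bounds and the final step count -/

/-- From `2 ^ (clog - 1) < n` and `log 2 > 1 / 2`, the left side is at most `2 + 2 log n` in the
nontrivial case. -/
theorem clog_add_one_le (n : ℕ) : ((Nat.clog 2 n + 1 : ℕ) : ℝ) ≤ 4 * max 1 (Real.log n) := by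
  have h2 := Real.log_two_gt_d9
  rcases Nat.eq_zero_or_pos (Nat.clog 2 n) with h | h
  · rw [h]
    have := le_max_left 1 (Real.log n)
    push_cast
    linarith
  · have hlt : 2 ^ (Nat.clog 2 n - 1) < n := (Nat.lt_clog_iff_pow_lt (by decide)).mp (by omega)
    have hlt' : (2 : ℝ) ^ (Nat.clog 2 n - 1) ≤ n := by exact_mod_cast hlt.le
    have := Real.log_le_log (by positivity) hlt'
    rw [Real.log_pow, Nat.cast_sub h, Nat.cast_one] at this
    have h1 : (1 : ℝ) ≤ Nat.clog 2 n := by exact_mod_cast h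
    have m1 := le_max_left 1 (Real.log n)
    have m2 := le_max_right 1 (Real.log n)
    push_cast
    nlinarith

theorem log_le_clog_add_one (hn : 0 < n) : Real.log n ≤ ((Nat.clog 2 n + 1 : ℕ) : ℝ) := by
  have h : (n : ℝ) ≤ 2 ^ Nat.clog 2 n := by exact_mod_cast Nat.le_pow_clog (by decide) n
  have := Real.log_le_log (by exact_mod_cast hn) h
  rw [Real.log_pow] at this
  have h2 := Real.log_two_lt_d9
  push_cast
  nlinarith [Nat.cast_nonneg (α := ℝ) (Nat.clog 2 n)]

end Main

end RealRAM

theorem theorem4p4 :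
    ∃ (f : ℝ → ℝ → ℝ) (C : ℕ) (P : RealRAM.Program),
      ∀ (p ε : ℝ), 2 ≤ p → 0 < ε →
      ∀ (n d : ℕ) (A : Matrix (Fin n) (Fin d) ℝ), 0 < d → A.rank = d →
        ∃ (t : ℕ) (τ : RealRAM.State),
          RealRAM.Runs P (RealRAM.input A p ε) t τ ∧
          (t : ℝ) ≤ f p ε * ((n : ℝ) * max 1 (Real.log n) * max 1 (Real.log (Real.log n)) *
            (d : ℝ) ^ C) ∧
          (∃ wbar : Fin n → ℝ,
            (∀ w, LewisWeights.IsLewisWeights A p w ↔ w = wbar) ∧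
            ∀ i, LewisWeights.Approx (1 + ε) (RealRAM.outputVector τ n i) (wbar i)) ∧
          (∃ Q : Matrix (Fin d) (Fin d) ℝ,
            (∀ M, LewisWeights.IsLewisForm A p M ↔ M = Q) ∧
            LewisWeights.LoewnerApprox (1 + ε) (RealRAM.outputMatrix τ d) Q) := by
  -- Here `16000 = 2 * 4 * 2000`: from the floor plus one, the integer logarithm and the cost per
  -- round. The exponent `4` is `3` from a round plus `1` from the number of rounds.
  refine ⟨fun p ε => 16000 * LewisWeights.iterationFactor p ε, 4, RealRAM.lewisProgram,
    fun p ε hp hε n d A hd hA => ?_⟩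
  have hn := LewisWeights.pos_of_rank hd hA
  have hκ := LewisWeights.one_le_iterationFactor hp hε
  obtain ⟨w, Q, hw, hQ, hQw⟩ := LewisWeights.exists_unique_lewis hd hp hA
  set κ := LewisWeights.iterationFactor p ε
  set L : ℝ := ((Nat.clog 2 n + 1 : ℕ) : ℝ) with hL
  obtain ⟨t, τ, ht, hr, hv, hM⟩ := RealRAM.exists_runs_lewisProgram hp hε hd hA rfl
  set T := ⌊κ * (d * L)⌋₊ + 1 with hT
  have hd1 : (1 : ℝ) ≤ d := by exact_mod_cast hd
  have hL1 : 1 ≤ L := by rw [hL]; push_cast; linarith [Nat.cast_nonneg (α := ℝ) (Nat.clog 2 n)]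
  have hκdL : 1 ≤ κ * (d * L) := one_le_mul_of_one_le_of_one_le hκ
    (one_le_mul_of_one_le_of_one_le hd1 hL1)
  have hTlow : κ * (d * Real.log n) ≤ T := by
    refine le_trans ?_ (Nat.lt_floor_add_one (κ * (d * L))).le |>.trans_eq (by rw [hT]; push_cast; rfl)
    gcongr
    exact RealRAM.log_le_clog_add_one hn
  have hTup : (T : ℝ) ≤ 2 * (κ * (d * L)) := by
    have := Nat.floor_le (a := κ * (d * L)) (by linarith)
    rw [hT]; push_cast; linarith
  obtain ⟨hform, hweights⟩ :=
    LewisWeights.averageGram_approx hd hp hA hε (by omega) hTlow ((hw w).mpr rfl)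
  refine ⟨t, τ, hr, ?_, ⟨w, hw, fun i => ?_⟩, Q, hQ, ?_⟩
  · have h1 : (t : ℝ) ≤ T * (2000 * (n * d ^ 3)) := by exact_mod_cast ht
    -- The iterated logarithm is pure slack: the count is bounded without it, and this factor is at
    -- least `1`.
    have hm : (1 : ℝ) ≤ max 1 (Real.log (Real.log n)) := le_max_left _ _
    calc (t : ℝ) ≤ T * (2000 * (n * d ^ 3)) := h1
      _ ≤ 2 * (κ * (d * (4 * max 1 (Real.log n)))) * (2000 * (n * d ^ 3)) := by
          gcongr
          refine hTup.trans ?_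
          gcongr
          exact RealRAM.clog_add_one_le n
      _ = 16000 * κ * (n * max 1 (Real.log n) * 1 * d ^ 4) := by ring
      _ ≤ _ := by gcongr
  · rw [hv i]
    exact hweights i
  · rw [hM, hQw]
    exact hform
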